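/- Fix a probability space. For $N,T\ge 1$ consider the panel data $$X_{i,t}=\mu_i+\delta_i\,1\{t>t_0\}+\gamma_i\eta_t+e_{i,t},\qquad 1\le i\le N,\ 1\le t\le T,$$ where $t_0=\lfloor T\theta\rfloor$ with a fixed $\theta\in(0,1)$, the real numbers $\delta_i=\delta_i(N,T)$ and $\gamma_i=\gamma_i(N,T)$ may depend on $N$ and $T$, and $\{\eta_t\}_{t\in\mathbb Z}$, $\{e_{i,t}\}_{t\in\mathbb Z}$ ($i\ge1$) are real processes, not depending on $N,T$, with $E e_{i,t}=0$. Put $S_i(t)=\sum_{s=1}^tX_{i,s}$ and let $\hat t_{N,T}$ be any maximizer over $1\le t<T$ of $$\sum_{i=1}^N\Bigl(S_i(t)-\frac tT S_i(T)\Bigr)^2 .$$ Let $U_{i,\nu}(t)=E\bigl|\sum_{s=1}^te_{i,s}\bigr|^\nu$, and let $\Delta_{N,T}=\sum_{i=1}^N\delta_i^2$, $\Gamma_{N,T}=\sum_{i=1}^N\gamma_i^2$, $\Sigma_{N,T}=\sum_{i=1}^N\delta_i\gamma_i$. All limits and all $o(\cdot)$, $O(\cdot)$ in $N,T$ are taken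 as $\min(N,T)\to\infty$. Assume: 1. the sequences $\{e_{i,t}\}_{t\in\mathbb Z}$, $i\ge1$, are independent of each other, and each of them, as well as $\{\eta_t\}_{t\in\mathbb Z}$, is strictly stationary (the dependence between $\eta$ and the $e_{i,\cdot}$ is arbitrary); 2. there are constants $0<C_1\le C_2<\infty$ and $\sigma_i\in[C_1,C_2]$ with $\displaystyle\max_{1\le i\le N}\sup_{1\le t\le T}\Bigl|\frac1tU_{i,2}(t)-\sigma_i^2\Bigr|=o(1)$; 3. for some $\kappa>4$, all $E|e_{i,t}|^{\kappa}$ are finite and $\displaystyle\frac1N\sup_{1\le t\le T}\sum_{i=1}^N\bigl(t^{-\kappa/2}U_{i,\kappa}(t)\bigr)^2=O(1)$; 4. for some $\bar\kappa>2$, all $E|\eta_t|^{\bar\kappa}$ are finite, $E\eta_t=0$, and, as $t\to\infty$, $E\bigl(\sum_{s=1}^t\eta_s\bigr)^2=t+o(t)$ and $E\bigl|\sum_{s=1}^t\eta_s\bigr|^{\bar\kappa}=O(t^{\bar\kappa/2})$; 5. $T\Delta_{N,T}/N\to\infty$ and $\Gamma_{N,T}/(T\Delta_{N,T})^{1/2}\to0$;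 6. $\Delta_{N,T}\to\infty$ and $\Sigma_{N,T}/\Delta_{N,T}\to0$. Then $P\{\hat t_{N,T}=t_0\}\to1$ as $\min(N,T)\to\infty$. -/

import Mathlib

open MeasureTheory ProbabilityTheory Filter Topology Asymptotics

/-- Panels are labelled `0, …, N - 1` (label `i` is the panel number `i + 1`), time runs through `ℤ`.
A two-sided real process is strictly stationary if all its time shifts have the same law
on `ℤ → ℝ`. -/
def StrictlyStationary {Ω : Type*} [MeasurableSpace Ω] (P : Measure Ω) (Y : ℤ → Ω → ℝ) : Prop :=
  ∀ h : ℤ, IdentDistrib (fun ω (t : ℤ) => Y (t + h) ω) (fun ω (t : ℤ) => Y t ω) P P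

/-- The partial sum `∑_{s=1}^t Y_s`. -/
noncomputable def partialSum {Ω : Type*} (Y : ℤ → Ω → ℝ) (t : ℕ) (ω : Ω) : ℝ :=
  ∑ s ∈ Finset.Icc 1 t, Y (s : ℤ) ω

/-- The long run moment `E |∑_{s=1}^t Y_s| ^ ν`. -/
noncomputable def longRunMoment {Ω : Type*} [MeasurableSpace Ω] (P : Measure Ω)
    (Y : ℤ → Ω → ℝ) (ν : ℝ) (t : ℕ) : ℝ :=
  ∫ ω, |partialSum Y t ω| ^ ν ∂P

/-- The change point `t₀ = ⌊T θ⌋`. -/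
noncomputable def changePoint (θ : ℝ) (T : ℕ) : ℕ := ⌊(T : ℝ) * θ⌋₊

/-- The observation `X_{i,t} = μ_i + δ_i 1{t > t₀} + γ_i η_t + e_{i,t}`; the changes `δ N T i` and the
loadings `γ N T i` may depend on `N` and `T`. -/
noncomputable def panelObs {Ω : Type*} (μ : ℕ → ℝ) (δ γ : ℕ → ℕ → ℕ → ℝ) (θ : ℝ)
    (η : ℤ → Ω → ℝ) (e : ℕ → ℤ → Ω → ℝ) (N T i : ℕ) (t : ℤ) (ω : Ω) : ℝ :=
  μ i + δ N T i * (if (changePoint θ T : ℤ) < t then 1 else 0) + γ N T i * η t ω + e i t ω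

/-- The aggregated CUSUM `∑_{i ≤ N} (S_i(t) - (t / T) S_i(T))²` of the panels `X i`. -/
noncomputable def cusum {Ω : Type*} (X : ℕ → ℤ → Ω → ℝ) (N T t : ℕ) (ω : Ω) : ℝ :=
  ∑ i ∈ Finset.range N,
    (partialSum (X i) t ω - ((t : ℝ) / (T : ℝ)) * partialSum (X i) T ω) ^ 2

/-- The set of maximizers of the aggregated CUSUM over `1 ≤ t < T`. -/
def cusumArgmax {Ω : Type*} (X : ℕ → ℤ → Ω → ℝ) (N T : ℕ) (ω : Ω) : Set ℕ :=
  {t | t ∈ Set.Ico 1 T ∧ IsMaxOn (fun s => cusum X N T s ω) (Set.Ico 1 T) t}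

theorem cusumArgmax_nonempty {Ω : Type*} (X : ℕ → ℤ → Ω → ℝ) (N T : ℕ) (hT : 2 ≤ T) (ω : Ω) :
    (cusumArgmax X N T ω).Nonempty := by
  obtain ⟨t, ht, h⟩ := Set.exists_max_image (Set.Ico 1 T) (fun s => cusum X N T s ω)
    (Set.finite_Ico 1 T) ⟨1, by simp; omega⟩
  exact ⟨t, ht, fun s hs => h s hs⟩

/-- `∑_{i ≤ N} a_i b_i` for arrays depending on `N` and `T`: this gives `Δ` (for `δ, δ`),
`Γ` (for `γ, γ`) and `Σ` (for `δ, γ`). -/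
noncomputable def crossSum (a b : ℕ → ℕ → ℕ → ℝ) (p : ℕ × ℕ) : ℝ :=
  ∑ i ∈ Finset.range p.1, a p.1 p.2 i * b p.1 p.2 i

/-- `Δ_{N,T} = ∑ δ_i²` at `p = (N, T)`. -/
noncomputable def changeSize (δ : ℕ → ℕ → ℕ → ℝ) (p : ℕ × ℕ) : ℝ := crossSum δ δ p

/-- `Γ_{N,T} = ∑ γ_i²` at `p = (N, T)`. -/
noncomputable def loadingSize (γ : ℕ → ℕ → ℕ → ℝ) (p : ℕ × ℕ) : ℝ := crossSum γ γ p

/-- Independence between the panels of errors, and stationarity of each error sequence and of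
the common factor (whose dependence on the errors is not restricted). -/
structure IndependentStationary {Ω : Type*} [MeasurableSpace Ω] (P : Measure Ω)
    (η : ℤ → Ω → ℝ) (e : ℕ → ℤ → Ω → ℝ) : Prop where
  measurable_factor : ∀ t, Measurable (η t)
  measurable_error : ∀ i t, Measurable (e i t)
  indep : iIndepFun (fun i ω (t : ℤ) => e i t ω) P
  stationary_factor : StrictlyStationary P η
  stationary_error : ∀ i, StrictlyStationary P (e i)

/-- The conditions on the errors: mean zero, uniform second order long run moments, and
averaged long run moments of some order `κ > 4`. The membership in `L^κ` says that these
moments are finite. On `ℕ × ℕ` the filter `atTop` is `min(N, T) → ∞`. -/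
structure ErrorMoments {Ω : Type*} [MeasurableSpace Ω] (P : Measure Ω)
    (e : ℕ → ℤ → Ω → ℝ) : Prop where
  mean_zero : ∀ i t, Integrable (e i t) P ∧ ∫ ω, e i t ω ∂P = 0
  second : ∃ (σ : ℕ → ℝ) (C₁ C₂ : ℝ), 0 < C₁ ∧ C₁ ≤ C₂ ∧ (∀ i, C₁ ≤ σ i ∧ σ i ≤ C₂) ∧
    (fun p : ℕ × ℕ => ⨆ i : Fin p.1, ⨆ t : Set.Icc 1 p.2,
        |1 / ((t : ℕ) : ℝ) * longRunMoment P (e i) 2 t - σ i ^ 2|)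
      =o[atTop] (fun _ => (1 : ℝ))
  higher : ∃ κ : ℝ, 4 < κ ∧ (∀ i t, MemLp (e i t) (ENNReal.ofReal κ) P) ∧
    (fun p : ℕ × ℕ => 1 / (p.1 : ℝ) * ⨆ t : Set.Icc 1 p.2, ∑ i ∈ Finset.range p.1,
        (1 / ((t : ℕ) : ℝ) ^ (κ / 2) * longRunMoment P (e i) κ t) ^ 2)
      =O[atTop] (fun _ => (1 : ℝ))

/-- The conditions on the common factor, with some order `κ > 2` of the moments. -/
structure FactorMoments {Ω : Type*} [MeasurableSpace Ω] (P : Measure Ω)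
    (η : ℤ → Ω → ℝ) : Prop where
  mean_zero : ∀ t, Integrable (η t) P ∧ ∫ ω, η t ω ∂P = 0
  second : (fun t : ℕ => ∫ ω, partialSum η t ω ^ 2 ∂P - (t : ℝ)) =o[atTop] (fun t => (t : ℝ))
  higher : ∃ κ : ℝ, 2 < κ ∧ (∀ t, MemLp (η t) (ENNReal.ofReal κ) P) ∧
    (fun t : ℕ => longRunMoment P η κ t) =O[atTop] (fun t => (t : ℝ) ^ (κ / 2))

/-- The changes are not too small and the loadings not too large. -/
structure SizeConditions (δ γ : ℕ → ℕ → ℕ → ℝ) : Prop where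
  change : Tendsto (fun p : ℕ × ℕ => (p.2 : ℝ) * changeSize δ p / (p.1 : ℝ)) atTop atTop
  loading : Tendsto
    (fun p : ℕ × ℕ => loadingSize γ p / ((p.2 : ℝ) * changeSize δ p) ^ (1 / 2 : ℝ)) atTop (𝓝 0)

/-! Forming bridges removes the means, so the CUSUM is `Δ g²` plus noise, where `g` is the bridge of
the step `1{t > t₀}`. Since `|g|` is a tent with its peak at `t₀` and `t₀` is a fixed fraction of
`T`, the signal loses at least `c₀ Δ T k` at distance `k = |t - t₀|` (`stepBridge_sq_sub_sq_ge`). It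
suffices that, with probability close to one and for all `t ≠ t₀` at once, everything else in the
CUSUM changes by less than that.

The randomness enters through four processes: the bridge of the factor, the error bridges weighted
by `δ` and by `γ`, and the centered sum of squared error bridges. Each has increments with second
moment at most a scale times the length. Dyadic chaining (`exists_increment_majorant`) then bounds
all squared increments from `t₀` by `k^{3/2}` times that scale, up to a random factor with bounded
mean. This is weaker than the order `k` but enough: for `1 ≤ k ≤ T` it yields both `|increment| ≲ k`
and `increment² ≲ k √T`, so every noise term is linear in `k` and `k` cancels
(`quadratic_comparison`). What is left is to compare `|Σ| T`, `√Δ T`, `(Γ + 1) √T`, `√(N T)` and `N`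
with `Δ T`, which is what the size conditions provide (`eventually_noise_lt_signal`).

The term of order `N` is the drift of the mean of the squared error bridges. It is explicit because
the errors do not depend on `N, T`: the uniform second moment condition forces the variances of
partial sums to be exactly linear (`ErrorMoments.exists_second`). The factor and the errors are
multiplied only after both have been bounded pathwise, so their dependence plays no role. -/

/-- Increments of `S` have second moments at most `C` times the length of the time interval. -/
structure SquareIncrementBound {Ω : Type*} [MeasurableSpace Ω] (P : Measure Ω)
    (S : ℕ → Ω → ℝ) (C : ℝ) : Prop where
  integrable : ∀ a b, a ≤ b → Integrable (fun ω => (S b ω - S a ω) ^ 2) P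
  integral_le : ∀ a b, a ≤ b → ∫ ω, (S b ω - S a ω) ^ 2 ∂P ≤ C * ((b : ℝ) - a)

/-! ### Maximal inequalities from second moments of increments -/

section Maximal

variable {Ω : Type*} [MeasurableSpace Ω] {P : Measure Ω}

/-- Chaining by halving: a point in the right half is reached through the midpoint, so the majorants
of the two halves and the midpoint increment suffice. An uneven splitting of the square makes the
mean grow by `5/2` per doubling. This beats the `2^{3/2}` needed later, and no moment above the
second is used. -/
theorem SquareIncrementBound.exists_dyadic_majorant {S : ℕ → Ω → ℝ} {C : ℝ}
    (h : SquareIncrementBound P S C) (J a : ℕ) :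
    ∃ M : Ω → ℝ, Integrable M P ∧ (∀ ω, 0 ≤ M ω) ∧
      ∫ ω, M ω ∂P ≤ C * (11 * (5 / 2 : ℝ) ^ J - 10 * 2 ^ J) ∧
      ∀ k ≤ 2 ^ J, ∀ ω, (S (a + k) ω - S a ω) ^ 2 ≤ M ω := by
  induction J generalizing a with
  | zero =>
    refine ⟨fun ω => (S (a + 1) ω - S a ω) ^ 2, h.integrable _ _ (by omega),
      fun ω => sq_nonneg _, ?_, ?_⟩
    · have := h.integral_le a (a + 1) (by omega)
      push_cast at this
      norm_num at this ⊢
      exact this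
    · intro k hk ω
      have : k = 0 ∨ k = 1 := by simp at hk; omega
      rcases this with rfl | rfl
      · simpa using sq_nonneg _
      · exact le_rfl
  | succ J ih =>
    obtain ⟨M₁, hi₁, hn₁, hb₁, hm₁⟩ := ih a
    obtain ⟨M₂, hi₂, hn₂, hb₂, hm₂⟩ := ih (a + 2 ^ J)
    have hi₀ := h.integrable a (a + 2 ^ J) (Nat.le_add_right _ _)
    have hb₀ := h.integral_le a (a + 2 ^ J) (Nat.le_add_right _ _)
    have hi₃ : Integrable (fun ω => M₁ ω + M₂ ω) P := hi₁.add hi₂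
    -- The weights come from `(x + y)² ≤ 5 x² + (5/4) y²`. The means then obey `m_{J+1} ≤ 5 C 2^J +
    -- (5/2) m_J` with `m_0 ≤ C`, which is solved by the stated bound.
    refine ⟨fun ω => 5 * (S (a + 2 ^ J) ω - S a ω) ^ 2 + 5 / 4 * (M₁ ω + M₂ ω),
      (hi₀.const_mul _).add (hi₃.const_mul _), ?_, ?_, ?_⟩
    · intro ω
      have := hn₁ ω; have := hn₂ ω
      positivity
    · beta_reduce
      rw [integral_add (hi₀.const_mul _) (hi₃.const_mul _), integral_const_mul,
        integral_const_mul, integral_add hi₁ hi₂]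
      push_cast at hb₀
      rw [pow_succ, pow_succ]
      nlinarith
    · intro k hk ω
      have e₁ := hn₁ ω
      have e₂ := hn₂ ω
      by_cases hk' : k ≤ 2 ^ J
      · have e₃ := hm₁ k hk' ω
        nlinarith [sq_nonneg (S (a + 2 ^ J) ω - S a ω)]
      · have e₃ := hm₂ (k - 2 ^ J) (by rw [pow_succ] at hk; omega) ω
        rw [show a + 2 ^ J + (k - 2 ^ J) = a + k by omega] at e₃
        nlinarith [sq_nonneg (4 * (S (a + 2 ^ J) ω - S a ω) - (S (a + k) ω - S (a + 2 ^ J) ω))]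

theorem SquareIncrementBound.nonneg {S : ℕ → Ω → ℝ} {C : ℝ}
    (h : SquareIncrementBound P S C) : 0 ≤ C := by
  have h₁ := h.integral_le 0 1 (by omega)
  have h₂ : 0 ≤ ∫ ω, (S 1 ω - S 0 ω) ^ 2 ∂P := integral_nonneg fun ω => sq_nonneg _
  simpa using h₂.trans h₁

/-- One variable controls all `k ≤ n`: sum the dyadic majorants with weights `(14/5)^{-j}`. The base
lies between `5/2`, so that the means are summable, and `2^{3/2}`, so that the weight is at most `k
√k` on the block `2^j ≤ k < 2^{j+1}`. -/
theorem SquareIncrementBound.exists_majorant {S : ℕ → Ω → ℝ} {C : ℝ}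
    (h : SquareIncrementBound P S C) (n : ℕ) :
    ∃ R : Ω → ℝ, Integrable R P ∧ (∀ ω, 0 ≤ R ω) ∧ ∫ ω, R ω ∂P ≤ 257 * C ∧
      ∀ k ≤ n, ∀ ω, (S k ω - S 0 ω) ^ 2 ≤ R ω * (k * √k) := by
  choose M hi hn hb hm using fun j => h.exists_dyadic_majorant (j + 1) 0
  have hC := h.nonneg
  have hw : ∀ j : ℕ, (7 / 5 : ℝ) ^ j ≤ √(2 ^ j) := by
    intro j
    apply Real.le_sqrt_of_sq_le
    rw [← pow_mul, mul_comm, pow_mul]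
    gcongr
    norm_num
  have hw' : ∀ j : ℕ, 0 < (14 / 5 : ℝ) ^ j := fun j => by positivity
  refine ⟨fun ω => ∑ j ∈ Finset.range (n + 1), ((14 / 5 : ℝ) ^ j)⁻¹ * M j ω,
    integrable_finsetSum _ fun j _ => (hi j).const_mul _,
    fun ω => Finset.sum_nonneg fun j _ => mul_nonneg (by positivity) (hn j ω), ?_, ?_⟩
  · rw [integral_finsetSum _ fun j _ => (hi j).const_mul _]
    simp_rw [integral_const_mul]
    calc ∑ j ∈ Finset.range (n + 1), ((14 / 5 : ℝ) ^ j)⁻¹ * ∫ ω, M j ω ∂P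
        ≤ ∑ j ∈ Finset.range (n + 1), C * (55 / 2) * (25 / 28 : ℝ) ^ j := by
          refine Finset.sum_le_sum fun j _ => ?_
          rw [inv_mul_le_iff₀ (hw' j)]
          refine (hb j).trans ?_
          have : (14 / 5 : ℝ) ^ j * (C * (55 / 2) * (25 / 28 : ℝ) ^ j)
              = C * (11 * (5 / 2 : ℝ) ^ (j + 1)) := by
            have : (5 / 2 : ℝ) ^ j = (14 / 5 : ℝ) ^ j * (25 / 28 : ℝ) ^ j := by
              rw [← mul_pow]; norm_num
            rw [pow_succ, this]; ring
          rw [this]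
          gcongr
          have : (0 : ℝ) ≤ 10 * 2 ^ (j + 1) := by positivity
          linarith
      -- The geometric series with ratio `25/28` is at most `28/3`, and `(55/2)(28/3) < 257`.
      _ ≤ 257 * C := by
          rw [← Finset.mul_sum, geom_sum_eq (by norm_num)]
          have : (0 : ℝ) ≤ (25 / 28 : ℝ) ^ (n + 1) := by positivity
          rw [show ((25 / 28 : ℝ) ^ (n + 1) - 1) / (25 / 28 - 1)
            = 28 / 3 - 28 / 3 * (25 / 28 : ℝ) ^ (n + 1) by ring]
          nlinarith [mul_nonneg hC this]
  · intro k hk ω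
    rcases Nat.eq_zero_or_pos k with rfl | hk0
    · simp
    set j := Nat.log 2 k
    have hj₁ : 2 ^ j ≤ k := Nat.pow_log_le_self 2 hk0.ne'
    have hj₂ : k < 2 ^ (j + 1) := Nat.lt_pow_succ_log_self (by norm_num) k
    have hjn : j ∈ Finset.range (n + 1) := by
      have := Nat.log_le_self 2 k
      simp only [Finset.mem_range]; omega
    have h₁ := hm j k hj₂.le ω
    rw [zero_add] at h₁
    have h₂ := Finset.single_le_sum
      (f := fun j => ((14 / 5 : ℝ) ^ j)⁻¹ * M j ω) (s := Finset.range (n + 1))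
      (fun j _ => mul_nonneg (by positivity) (hn j ω)) hjn
    have hj₁' : (2 : ℝ) ^ j ≤ k := by exact_mod_cast hj₁
    have h₃ : (14 / 5 : ℝ) ^ j ≤ k * √k := by
      calc (14 / 5 : ℝ) ^ j = 2 ^ j * (7 / 5 : ℝ) ^ j := by rw [← mul_pow]; norm_num
        _ ≤ k * √k := by
          gcongr
          exact (hw j).trans (Real.sqrt_le_sqrt hj₁')
    have h₄ : 0 ≤ ((14 / 5 : ℝ) ^ j)⁻¹ * M j ω := mul_nonneg (by positivity) (hn j ω)
    calc (S k ω - S 0 ω) ^ 2 ≤ M j ω := h₁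
      _ = ((14 / 5 : ℝ) ^ j)⁻¹ * M j ω * (14 / 5 : ℝ) ^ j := by
          field_simp
      _ ≤ _ := by
          exact mul_le_mul h₂ h₃ (by positivity) (h₄.trans h₂)

/-- A maximal inequality of Hájek–Rényi type around the time `t₀` for a process on `0, …, T`. -/
theorem exists_increment_majorant {Z : ℕ → Ω → ℝ} {C : ℝ} {T t₀ : ℕ} (hT : 0 < T) (ht₀ : t₀ ≤ T)
    (hZ : ∀ ω, Z 0 ω = 0)
    (hint : ∀ a b, a ≤ b → b ≤ T → Integrable (fun ω => (Z b ω - Z a ω) ^ 2) P)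
    (hle : ∀ a b, a ≤ b → b ≤ T → ∫ ω, (Z b ω - Z a ω) ^ 2 ∂P ≤ C * ((b : ℝ) - a)) :
    ∃ R : Ω → ℝ, Integrable R P ∧ (∀ ω, 0 ≤ R ω) ∧ ∫ ω, R ω ∂P ≤ 515 * C ∧
      (∀ ω, Z t₀ ω ^ 2 ≤ R ω * T) ∧
      ∀ t ≤ T, ∀ ω, (Z t ω - Z t₀ ω) ^ 2 ≤ R ω * (|(t : ℝ) - t₀| * √|(t : ℝ) - t₀|) := by
  have hC : 0 ≤ C := by
    have h₁ := hle 0 1 (by omega) hT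
    have h₂ : 0 ≤ ∫ ω, (Z 1 ω - Z 0 ω) ^ 2 ∂P := integral_nonneg fun ω => sq_nonneg _
    simpa using h₂.trans h₁
  -- The process run forward from `t₀` is stopped at `T`, and the one run backward is stopped at `0`
  -- by truncated subtraction. Stopping only shortens intervals, so both keep the constant `C`.
  have hf : SquareIncrementBound P (fun k => Z (min (t₀ + k) T)) C := by
    refine ⟨fun a b hab => hint _ _ (by omega) (by omega),
      fun a b hab => (hle _ _ (by omega) (by omega)).trans ?_⟩
    refine mul_le_mul_of_nonneg_left ?_ hC
    have : ((min (t₀ + b) T : ℕ) : ℝ) + a ≤ b + (min (t₀ + a) T : ℕ) := by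
      exact_mod_cast (by omega : min (t₀ + b) T + a ≤ b + min (t₀ + a) T)
    linarith
  have hb : SquareIncrementBound P (fun k => Z (t₀ - k)) C := by
    have hs : ∀ a b : ℕ, (fun ω => (Z (t₀ - b) ω - Z (t₀ - a) ω) ^ 2)
        = fun ω => (Z (t₀ - a) ω - Z (t₀ - b) ω) ^ 2 := fun a b => by
      funext ω; ring
    refine ⟨fun a b hab => ?_, fun a b hab => ?_⟩
    · rw [hs]; exact hint _ _ (by omega) (by omega)
    · rw [hs]
      refine (hle _ _ (by omega) (by omega)).trans (mul_le_mul_of_nonneg_left ?_ hC)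
      have : ((t₀ - a : ℕ) : ℝ) + a ≤ b + (t₀ - b : ℕ) := by
        exact_mod_cast (by omega : (t₀ - a) + a ≤ b + (t₀ - b))
      linarith
  obtain ⟨R₁, hi₁, hn₁, hb₁, hm₁⟩ := hf.exists_majorant T
  obtain ⟨R₂, hi₂, hn₂, hb₂, hm₂⟩ := hb.exists_majorant T
  have hT' : (0 : ℝ) < T := by exact_mod_cast hT
  have hi₀ := hint 0 t₀ (by omega) ht₀
  have hb₀ := hle 0 t₀ (by omega) ht₀
  simp only [hZ, sub_zero, Nat.cast_zero] at hi₀ hb₀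
  have hn₀ : ∀ ω, 0 ≤ (T : ℝ)⁻¹ * Z t₀ ω ^ 2 := fun ω => by positivity
  have hr : ∀ ω, 0 ≤ (T : ℝ)⁻¹ * Z t₀ ω ^ 2 + R₁ ω + R₂ ω := fun ω =>
    add_nonneg (add_nonneg (hn₀ ω) (hn₁ ω)) (hn₂ ω)
  -- The three summands serve the value at `t₀` and the two directions: `515 = 1 + 257 + 257`.
  refine ⟨fun ω => (T : ℝ)⁻¹ * Z t₀ ω ^ 2 + R₁ ω + R₂ ω,
    ((hi₀.const_mul _).add hi₁).add hi₂, hr, ?_, ?_, ?_⟩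
  · have hi₃ : Integrable (fun ω => (T : ℝ)⁻¹ * Z t₀ ω ^ 2 + R₁ ω) P := (hi₀.const_mul _).add hi₁
    beta_reduce
    rw [integral_add hi₃ hi₂, integral_add (hi₀.const_mul _) hi₁,
      integral_const_mul]
    have : (T : ℝ)⁻¹ * ∫ ω, Z t₀ ω ^ 2 ∂P ≤ C := by
      rw [inv_mul_le_iff₀ hT']
      refine hb₀.trans ?_
      rw [mul_comm]
      gcongr
    linarith
  · intro ω
    calc Z t₀ ω ^ 2 = (T : ℝ)⁻¹ * Z t₀ ω ^ 2 * T := by field_simp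
      _ ≤ _ := by
        gcongr
        linarith [hn₁ ω, hn₂ ω]
  · intro t ht ω
    rcases le_total t₀ t with h | h
    · have h₁ := hm₁ (t - t₀) (by omega) ω
      simp only [add_zero, min_eq_left ht₀] at h₁
      rw [show min (t₀ + (t - t₀)) T = t by omega, Nat.cast_sub h] at h₁
      rw [abs_of_nonneg (by simpa using h)]
      refine h₁.trans ?_
      have : (0 : ℝ) ≤ t - t₀ := by simpa using h
      gcongr
      linarith [hn₀ ω, hn₂ ω]
    · have h₁ := hm₂ (t₀ - t) (by omega) ω
      simp only [Nat.sub_zero] at h₁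
      rw [show t₀ - (t₀ - t) = t by omega, Nat.cast_sub h] at h₁
      rw [abs_sub_comm, abs_of_nonneg (by simpa using h)]
      refine h₁.trans ?_
      have : (0 : ℝ) ≤ t₀ - t := by simpa using h
      gcongr
      linarith [hn₀ ω, hn₁ ω]

/-- Outside an event of probability at most `515 / x`, the process and its increments at `t₀` are
bounded as their second moments suggest. -/
theorem measure_increment_bound [IsProbabilityMeasure P] {Z : ℕ → Ω → ℝ} {C x : ℝ} {T t₀ : ℕ}
    (hC : 0 < C) (hx : 0 < x) (hT : 0 < T) (ht₀ : t₀ ≤ T) (hZ : ∀ ω, Z 0 ω = 0)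
    (hint : ∀ a b, a ≤ b → b ≤ T → Integrable (fun ω => (Z b ω - Z a ω) ^ 2) P)
    (hle : ∀ a b, a ≤ b → b ≤ T → ∫ ω, (Z b ω - Z a ω) ^ 2 ∂P ≤ C * ((b : ℝ) - a)) :
    P {ω | ¬ (Z t₀ ω ^ 2 ≤ x * C * T ∧ ∀ t ≤ T,
        (Z t ω - Z t₀ ω) ^ 2 ≤ x * C * (|(t : ℝ) - t₀| * √|(t : ℝ) - t₀|))}
      ≤ ENNReal.ofReal (515 / x) := by
  obtain ⟨R, hi, hn, hb, h₀, h⟩ := exists_increment_majorant hT ht₀ hZ hint hle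
  have hmarkov := mul_meas_ge_le_integral_of_nonneg (Eventually.of_forall hn) hi (x * C)
  have hreal : P.real {ω | x * C ≤ R ω} ≤ 515 / x := by
    rw [le_div_iff₀ hx]
    have := hmarkov.trans hb
    nlinarith
  refine (measure_mono ?_).trans
    ((ENNReal.le_ofReal_iff_toReal_le (measure_ne_top P _) (by positivity)).2 hreal)
  intro ω hω
  by_contra hR
  simp only [Set.mem_ofPred_eq, not_le] at hR
  refine hω ⟨(h₀ ω).trans ?_, fun t ht => (h t ht ω).trans ?_⟩
  · gcongr
  · gcongr

end Maximal

/-! ### Moments of bridges of stationary sequences -/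

/-- The bridge `S(t) - (t / T) S(T)` of the partial sums of `Y`. -/
noncomputable def bridge {Ω : Type*} (Y : ℤ → Ω → ℝ) (T t : ℕ) (ω : Ω) : ℝ :=
  partialSum Y t ω - ((t : ℝ) / (T : ℝ)) * partialSum Y T ω

section Stationary

variable {Ω : Type*}

@[simp] theorem partialSum_zero (Y : ℤ → Ω → ℝ) (ω : Ω) : partialSum Y 0 ω = 0 := by
  simp [partialSum]

@[simp] theorem bridge_zero (Y : ℤ → Ω → ℝ) (T : ℕ) (ω : Ω) : bridge Y T 0 ω = 0 := by
  simp [bridge]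

theorem partialSum_sub_partialSum (Y : ℤ → Ω → ℝ) {a b : ℕ} (hab : a ≤ b) (ω : Ω) :
    partialSum Y b ω - partialSum Y a ω = ∑ s ∈ Finset.Icc 1 (b - a), Y ((s : ℤ) + a) ω := by
  obtain ⟨k, rfl⟩ := Nat.exists_eq_add_of_le hab
  rw [Nat.add_sub_cancel_left]
  induction k with
  | zero => simp
  | succ k ih =>
    have h₁ : partialSum Y (a + (k + 1)) ω
        = partialSum Y (a + k) ω + Y ((k + 1 : ℕ) + (a : ℤ)) ω := by
      rw [partialSum, ← add_assoc, Finset.sum_Icc_succ_top (by omega), partialSum]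
      congr 2
      push_cast
      ring
    rw [h₁, Finset.sum_Icc_succ_top (by omega), ← ih (by omega)]
    ring

variable [MeasurableSpace Ω] {P : Measure Ω} {Y : ℤ → Ω → ℝ}

theorem StrictlyStationary.identDistrib_partialSum_sub (h : StrictlyStationary P Y) {a b : ℕ}
    (hab : a ≤ b) :
    IdentDistrib (fun ω => partialSum Y b ω - partialSum Y a ω)
      (fun ω => partialSum Y (b - a) ω) P P := by
  have hu : Measurable fun y : ℤ → ℝ => ∑ s ∈ Finset.Icc 1 (b - a), y (s : ℤ) := by fun_prop
  have := (h a).comp hu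
  simp_rw [partialSum_sub_partialSum Y hab]
  exact this

theorem StrictlyStationary.integral_partialSum_sub_pow (h : StrictlyStationary P Y) {a b : ℕ}
    (hab : a ≤ b) (n : ℕ) :
    ∫ ω, (partialSum Y b ω - partialSum Y a ω) ^ n ∂P = ∫ ω, partialSum Y (b - a) ω ^ n ∂P :=
  ((h.identDistrib_partialSum_sub hab).comp (measurable_id.pow_const n)).integral_eq

theorem memLp_partialSum {p : ENNReal} (h : ∀ t, MemLp (Y t) p P) (t : ℕ) :
    MemLp (partialSum Y t) p P :=
  memLp_finsetSum _ fun s _ => h s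

theorem memLp_bridge {p : ENNReal} (h : ∀ t, MemLp (Y t) p P) (T t : ℕ) :
    MemLp (bridge Y T t) p P :=
  (memLp_partialSum h t).sub ((memLp_partialSum h T).const_mul _)

theorem memLp_four_integrable {f : Ω → ℝ} (h : MemLp f 4 P) : Integrable (fun ω => f ω ^ 4) P := by
  have := h.integrable_norm_pow (by norm_num)
  refine this.congr (Eventually.of_forall fun ω => ?_)
  simp only [Real.norm_eq_abs]
  exact Even.pow_abs (by decide) _

theorem integral_bridge_sub_sq_le (hs : StrictlyStationary P Y) (hY : ∀ t, MemLp (Y t) 2 P)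
    {c : ℝ} (hc : ∀ t : ℕ, ∫ ω, partialSum Y t ω ^ 2 ∂P ≤ c * t) {T a b : ℕ}
    (hab : a ≤ b) (hb : b ≤ T) :
    ∫ ω, (bridge Y T b ω - bridge Y T a ω) ^ 2 ∂P ≤ 4 * c * ((b : ℝ) - a) := by
  have hc₀ : 0 ≤ c := by
    have h₁ := hc 1
    have h₂ : 0 ≤ ∫ ω, partialSum Y 1 ω ^ 2 ∂P := integral_nonneg fun ω => sq_nonneg _
    simpa using h₂.trans h₁
  have hk : (0 : ℝ) ≤ (b : ℝ) - a := by simpa using hab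
  have hi₁ : Integrable (fun ω => 2 * (partialSum Y b ω - partialSum Y a ω) ^ 2) P :=
    ((memLp_partialSum hY b).sub (memLp_partialSum hY a)).integrable_sq.const_mul _
  have hi₂ : Integrable (fun ω => 2 * (((b : ℝ) - a) / T) ^ 2 * partialSum Y T ω ^ 2) P :=
    (memLp_partialSum hY T).integrable_sq.const_mul _
  calc ∫ ω, (bridge Y T b ω - bridge Y T a ω) ^ 2 ∂P
      ≤ ∫ ω, (2 * (partialSum Y b ω - partialSum Y a ω) ^ 2
          + 2 * (((b : ℝ) - a) / T) ^ 2 * partialSum Y T ω ^ 2) ∂P := by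
        refine integral_mono ((memLp_bridge hY T b).sub (memLp_bridge hY T a)).integrable_sq
          (hi₁.add hi₂) fun ω => ?_
        have e : bridge Y T b ω - bridge Y T a ω = (partialSum Y b ω - partialSum Y a ω)
            - ((b : ℝ) - a) / T * partialSum Y T ω := by
          simp only [bridge]; ring
        simp only [e]
        nlinarith [sq_nonneg (partialSum Y b ω - partialSum Y a ω
          + ((b : ℝ) - a) / T * partialSum Y T ω)]
    _ = 2 * ∫ ω, partialSum Y (b - a) ω ^ 2 ∂P
          + 2 * (((b : ℝ) - a) / T) ^ 2 * ∫ ω, partialSum Y T ω ^ 2 ∂P := by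
        rw [integral_add hi₁ hi₂, integral_const_mul, integral_const_mul,
          hs.integral_partialSum_sub_pow hab]
    _ ≤ 2 * (c * ((b : ℝ) - a)) + 2 * (((b : ℝ) - a) / T) ^ 2 * (c * T) := by
        have := hc (b - a)
        rw [Nat.cast_sub hab] at this
        gcongr
        exact hc T
    _ ≤ _ := by
        rcases Nat.eq_zero_or_pos T with rfl | hT
        · simp only [Nat.cast_zero, mul_zero, add_zero]
          nlinarith [mul_nonneg hc₀ hk]
        have hT' : (0 : ℝ) < T := by exact_mod_cast hT
        have h₁ : ((b : ℝ) - a) / T ≤ 1 := by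
          rw [div_le_one hT']
          have : (b : ℝ) ≤ T := by exact_mod_cast hb
          have : (0 : ℝ) ≤ a := Nat.cast_nonneg a
          linarith
        have h₂ : (((b : ℝ) - a) / T) ^ 2 * (c * T) = c * ((b : ℝ) - a) * (((b : ℝ) - a) / T) := by
          field_simp
        have h₃ := mul_le_of_le_one_right (mul_nonneg hc₀ hk) h₁
        linarith

theorem integral_bridge_sq (hs : StrictlyStationary P Y) (hY : ∀ t, MemLp (Y t) 2 P)
    {c : ℝ} (hc : ∀ t : ℕ, ∫ ω, partialSum Y t ω ^ 2 ∂P = c * t) {T t : ℕ} (ht : t ≤ T) :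
    ∫ ω, bridge Y T t ω ^ 2 ∂P = c * (t - (t : ℝ) ^ 2 / T) := by
  rcases Nat.eq_zero_or_pos T with rfl | hT
  · obtain rfl : t = 0 := by omega
    simp
  have hT' : (T : ℝ) ≠ 0 := by exact_mod_cast hT.ne'
  set r : ℝ := (t : ℝ) / T with hr
  have hi₁ : Integrable (fun ω => (1 - r) * partialSum Y t ω ^ 2) P :=
    (memLp_partialSum hY t).integrable_sq.const_mul _
  have hi₂ : Integrable (fun ω => (r ^ 2 - r) * partialSum Y T ω ^ 2) P :=
    (memLp_partialSum hY T).integrable_sq.const_mul _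
  have hi₃ : Integrable (fun ω => r * (partialSum Y T ω - partialSum Y t ω) ^ 2) P :=
    ((memLp_partialSum hY T).sub (memLp_partialSum hY t)).integrable_sq.const_mul _
  have hi₄ : Integrable (fun ω => (1 - r) * partialSum Y t ω ^ 2
      + (r ^ 2 - r) * partialSum Y T ω ^ 2) P := hi₁.add hi₂
  -- Polarization replaces the product of `S(t)` and `S(T)` by squares of `S(t)`, `S(T)` and `S(T) -
  -- S(t)`, so stationarity and the variances of partial sums determine the result.
  have h : (fun ω => bridge Y T t ω ^ 2) = fun ω => (1 - r) * partialSum Y t ω ^ 2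
      + (r ^ 2 - r) * partialSum Y T ω ^ 2
      + r * (partialSum Y T ω - partialSum Y t ω) ^ 2 := by
    funext ω
    simp only [bridge, ← hr]
    ring
  rw [h, integral_add hi₄ hi₃, integral_add hi₁ hi₂, integral_const_mul, integral_const_mul,
    integral_const_mul, hs.integral_partialSum_sub_pow ht, hc, hc, hc, Nat.cast_sub ht, hr]
  field_simp
  ring

theorem integral_bridge_sub_pow_four_le (hs : StrictlyStationary P Y)
    (hY : ∀ t, MemLp (Y t) 4 P) {T a b : ℕ} (hab : a ≤ b) :
    ∫ ω, (bridge Y T b ω - bridge Y T a ω) ^ 4 ∂P ≤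
      8 * (∫ ω, partialSum Y (b - a) ω ^ 4 ∂P
        + (((b : ℝ) - a) / T) ^ 4 * ∫ ω, partialSum Y T ω ^ 4 ∂P) := by
  have hi₁ : Integrable (fun ω => 8 * (partialSum Y b ω - partialSum Y a ω) ^ 4) P :=
    (memLp_four_integrable ((memLp_partialSum hY b).sub (memLp_partialSum hY a))).const_mul _
  have hi₂ : Integrable (fun ω => 8 * (((b : ℝ) - a) / T) ^ 4 * partialSum Y T ω ^ 4) P :=
    (memLp_four_integrable (memLp_partialSum hY T)).const_mul _
  calc ∫ ω, (bridge Y T b ω - bridge Y T a ω) ^ 4 ∂P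
      ≤ ∫ ω, (8 * (partialSum Y b ω - partialSum Y a ω) ^ 4
          + 8 * (((b : ℝ) - a) / T) ^ 4 * partialSum Y T ω ^ 4) ∂P := by
        refine integral_mono
          (memLp_four_integrable ((memLp_bridge hY T b).sub (memLp_bridge hY T a)))
          (hi₁.add hi₂) fun ω => ?_
        have e : bridge Y T b ω - bridge Y T a ω = (partialSum Y b ω - partialSum Y a ω)
            + (-(((b : ℝ) - a) / T * partialSum Y T ω)) := by
          simp only [bridge]; ring
        have := Even.add_pow_le (n := 4) (by decide)
          (a := partialSum Y b ω - partialSum Y a ω) (b := -(((b : ℝ) - a) / T * partialSum Y T ω))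
        simp only [e]
        refine this.trans (le_of_eq ?_)
        ring
    _ = _ := by
        rw [integral_add hi₁ hi₂, integral_const_mul, integral_const_mul,
          hs.integral_partialSum_sub_pow hab]
        ring

theorem add_three_pow_four_le (x y z : ℝ) : (x + y + z) ^ 4 ≤ 27 * (x ^ 4 + y ^ 4 + z ^ 4) := by
  have h₁ : (x + y + z) ^ 2 ≤ 3 * (x ^ 2 + y ^ 2 + z ^ 2) := by
    nlinarith [sq_nonneg (x - y), sq_nonneg (y - z), sq_nonneg (x - z)]
  have h₂ : (x ^ 2 + y ^ 2 + z ^ 2) ^ 2 ≤ 3 * (x ^ 4 + y ^ 4 + z ^ 4) := by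
    nlinarith [sq_nonneg (x ^ 2 - y ^ 2), sq_nonneg (y ^ 2 - z ^ 2), sq_nonneg (x ^ 2 - z ^ 2)]
  have h₃ : ((x + y + z) ^ 2) ^ 2 ≤ (3 * (x ^ 2 + y ^ 2 + z ^ 2)) ^ 2 := by gcongr
  nlinarith

theorem integral_bridge_add_pow_four_le (hY : ∀ t, MemLp (Y t) 4 P) {T a b : ℕ}
    (ha : a ≤ T) (hb : b ≤ T) :
    ∫ ω, (bridge Y T b ω + bridge Y T a ω) ^ 4 ∂P ≤
      27 * (∫ ω, partialSum Y b ω ^ 4 ∂P + ∫ ω, partialSum Y a ω ^ 4 ∂P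
        + 16 * ∫ ω, partialSum Y T ω ^ 4 ∂P) := by
  have hi : ∀ t, Integrable (fun ω => partialSum Y t ω ^ 4) P := fun t =>
    memLp_four_integrable (memLp_partialSum hY t)
  have hi₁ : Integrable (fun ω => partialSum Y b ω ^ 4 + partialSum Y a ω ^ 4) P :=
    (hi b).add (hi a)
  have hi₂ : Integrable (fun ω => 16 * partialSum Y T ω ^ 4) P := (hi T).const_mul _
  have hr : (((b : ℝ) + a) / T) ^ 4 ≤ 16 := by
    have h₁ : ((b : ℝ) + a) / T ≤ 2 := by
      refine div_le_of_le_mul₀ (by positivity) (by norm_num) ?_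
      have : (b : ℝ) ≤ T := by exact_mod_cast hb
      have : (a : ℝ) ≤ T := by exact_mod_cast ha
      linarith
    calc (((b : ℝ) + a) / T) ^ 4 ≤ 2 ^ 4 := by gcongr
      _ = 16 := by norm_num
  calc ∫ ω, (bridge Y T b ω + bridge Y T a ω) ^ 4 ∂P
      ≤ ∫ ω, 27 * (partialSum Y b ω ^ 4 + partialSum Y a ω ^ 4
          + 16 * partialSum Y T ω ^ 4) ∂P := by
        refine integral_mono
          (memLp_four_integrable ((memLp_bridge hY T b).add (memLp_bridge hY T a)))
          ((hi₁.add hi₂).const_mul _) fun ω => ?_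
        have e : bridge Y T b ω + bridge Y T a ω = partialSum Y b ω + partialSum Y a ω
            + (-(((b : ℝ) + a) / T * partialSum Y T ω)) := by
          simp only [bridge]; ring
        simp only [e]
        refine (add_three_pow_four_le _ _ _).trans ?_
        have h₁ : (-(((b : ℝ) + a) / T * partialSum Y T ω)) ^ 4
            = (((b : ℝ) + a) / T) ^ 4 * partialSum Y T ω ^ 4 := by ring
        have h₂ : (0 : ℝ) ≤ partialSum Y T ω ^ 4 := by positivity
        rw [h₁]
        gcongr
    _ = _ := by
        rw [integral_const_mul, integral_add hi₁ hi₂, integral_add (hi b) (hi a),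
          integral_const_mul]

theorem memLp_bridge_sq_sub (hY : ∀ t, MemLp (Y t) 4 P) (T a b : ℕ) :
    MemLp (fun ω => bridge Y T b ω ^ 2 - bridge Y T a ω ^ 2) 2 P := by
  have h : ∀ t, MemLp (fun ω => bridge Y T t ω ^ 2) 2 P := fun t => by
    have hm := memLp_bridge hY T t
    refine (memLp_two_iff_integrable_sq (hm.aestronglyMeasurable.pow 2)).2 ?_
    have := memLp_four_integrable hm
    refine this.congr (Eventually.of_forall fun ω => ?_)
    simp only [Pi.pow_apply]
    ring
  exact (h b).sub (h a)

/-- Factor the difference of squares as `x y`, with `x` an increment and `y` a sum of bridges.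
Fourth moments of order `k²` for `x` and `T²` for `y` would give order `k T`; the weights `T / k`
and `k / T` in `2 x² y² ≤ (T/k) x⁴ + (k/T) y⁴` are the ones that balance them. -/
theorem integral_bridge_sq_sub_sq_le (hs : StrictlyStationary P Y)
    (hY : ∀ t, MemLp (Y t) 4 P) {T a b : ℕ} (hab : a < b) (hb : b ≤ T) :
    ∫ ω, (bridge Y T b ω ^ 2 - bridge Y T a ω ^ 2) ^ 2 ∂P ≤
      T / ((b : ℝ) - a) * (4 * (∫ ω, partialSum Y (b - a) ω ^ 4 ∂P
        + (((b : ℝ) - a) / T) ^ 4 * ∫ ω, partialSum Y T ω ^ 4 ∂P))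
      + ((b : ℝ) - a) / T * (27 / 2 * (∫ ω, partialSum Y b ω ^ 4 ∂P
        + ∫ ω, partialSum Y a ω ^ 4 ∂P + 16 * ∫ ω, partialSum Y T ω ^ 4 ∂P)) := by
  have hk : (0 : ℝ) < (b : ℝ) - a := by simpa using hab
  have hT : (0 : ℝ) < T := by exact_mod_cast (by omega : 0 < T)
  set k : ℝ := (b : ℝ) - a
  have hi₁ : Integrable (fun ω => T / k / 2 * (bridge Y T b ω - bridge Y T a ω) ^ 4) P :=
    (memLp_four_integrable ((memLp_bridge hY T b).sub (memLp_bridge hY T a))).const_mul _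
  have hi₂ : Integrable (fun ω => k / T / 2 * (bridge Y T b ω + bridge Y T a ω) ^ 4) P :=
    (memLp_four_integrable ((memLp_bridge hY T b).add (memLp_bridge hY T a))).const_mul _
  calc ∫ ω, (bridge Y T b ω ^ 2 - bridge Y T a ω ^ 2) ^ 2 ∂P
      ≤ ∫ ω, (T / k / 2 * (bridge Y T b ω - bridge Y T a ω) ^ 4
          + k / T / 2 * (bridge Y T b ω + bridge Y T a ω) ^ 4) ∂P := by
        refine integral_mono (memLp_bridge_sq_sub hY T a b).integrable_sq
          (hi₁.add hi₂) fun ω => ?_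
        set x := bridge Y T b ω - bridge Y T a ω
        set y := bridge Y T b ω + bridge Y T a ω
        have e : (bridge Y T b ω ^ 2 - bridge Y T a ω ^ 2) ^ 2 = x ^ 2 * y ^ 2 := by
          simp only [x, y]; ring
        have e₂ : T / k / 2 * x ^ 4 + k / T / 2 * y ^ 4 - x ^ 2 * y ^ 2
            = (T * x ^ 2 - k * y ^ 2) ^ 2 / (2 * k * T) := by
          field_simp
          ring
        have : 0 ≤ (T * x ^ 2 - k * y ^ 2) ^ 2 / (2 * k * T) := by positivity
        simp only [e]
        linarith
    _ = T / k / 2 * ∫ ω, (bridge Y T b ω - bridge Y T a ω) ^ 4 ∂P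
          + k / T / 2 * ∫ ω, (bridge Y T b ω + bridge Y T a ω) ^ 4 ∂P := by
        rw [integral_add hi₁ hi₂, integral_const_mul, integral_const_mul]
    _ ≤ T / k / 2 * (8 * (∫ ω, partialSum Y (b - a) ω ^ 4 ∂P
          + (k / T) ^ 4 * ∫ ω, partialSum Y T ω ^ 4 ∂P))
        + k / T / 2 * (27 * (∫ ω, partialSum Y b ω ^ 4 ∂P + ∫ ω, partialSum Y a ω ^ 4 ∂P
          + 16 * ∫ ω, partialSum Y T ω ^ 4 ∂P)) := by
        gcongr
        · exact integral_bridge_sub_pow_four_le hs hY hab.le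
        · exact integral_bridge_add_pow_four_le hY (by omega) hb
    _ = _ := by ring

end Stationary

/-! ### Sums over independent panels -/

section Independence

/-- The bridge as a functional of a path. -/
noncomputable def pathBridge (T t : ℕ) (y : ℤ → ℝ) : ℝ :=
  ∑ s ∈ Finset.Icc 1 t, y (s : ℤ) - ((t : ℝ) / (T : ℝ)) * ∑ s ∈ Finset.Icc 1 T, y (s : ℤ)

variable {Ω : Type*}

/-- The sum `∑_{i ≤ N} w_i W_i(t)` of the error bridges. -/
noncomputable def weightedBridge (e : ℕ → ℤ → Ω → ℝ) (w : ℕ → ℝ) (N T t : ℕ) (ω : Ω) : ℝ :=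
  ∑ i ∈ Finset.range N, w i * bridge (e i) T t ω

/-- The centered sum `∑_{i ≤ N} (W_i(t)² - E W_i(t)²)` of the squared error bridges. -/
noncomputable def squaredBridge (e : ℕ → ℤ → Ω → ℝ) (v : ℕ → ℝ) (N T t : ℕ) (ω : Ω) : ℝ :=
  ∑ i ∈ Finset.range N, (bridge (e i) T t ω ^ 2 - v i * (t - (t : ℝ) ^ 2 / T))

theorem squaredBridge_sub (e : ℕ → ℤ → Ω → ℝ) (v : ℕ → ℝ) (N T a b : ℕ) (ω : Ω) :
    squaredBridge e v N T b ω - squaredBridge e v N T a ω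
      = ∑ i ∈ Finset.range N, ((bridge (e i) T b ω ^ 2 - bridge (e i) T a ω ^ 2)
        - (v i * (b - (b : ℝ) ^ 2 / T) - v i * (a - (a : ℝ) ^ 2 / T))) := by
  simp only [squaredBridge, ← Finset.sum_sub_distrib]
  exact Finset.sum_congr rfl fun i _ => by ring

variable [MeasurableSpace Ω] {P : Measure Ω}

/-- Independence removes the cross terms, and each variance is at most the raw second moment.
Squared bridges can therefore be estimated without centering. -/
theorem integral_sum_centered_sq_le [IsProbabilityMeasure P] {ξ : ℕ → Ω → ℝ}
    (hξ : ∀ i, MemLp (ξ i) 2 P) (hind : iIndepFun ξ P) {m : ℕ → ℝ}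
    (hm : ∀ i, ∫ ω, ξ i ω ∂P = m i) (N : ℕ) :
    ∫ ω, (∑ i ∈ Finset.range N, (ξ i ω - m i)) ^ 2 ∂P
      ≤ ∑ i ∈ Finset.range N, ∫ ω, ξ i ω ^ 2 ∂P := by
  have hsum : MemLp (∑ i ∈ Finset.range N, ξ i) 2 P := memLp_finsetSum' _ fun i _ => hξ i
  have hmean : ∫ ω, (∑ i ∈ Finset.range N, ξ i) ω ∂P = ∑ i ∈ Finset.range N, m i := by
    simp only [Finset.sum_apply]
    rw [integral_finsetSum _ fun i _ => (hξ i).integrable (by norm_num)]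
    exact Finset.sum_congr rfl fun i _ => hm i
  have hvar : ∫ ω, (∑ i ∈ Finset.range N, (ξ i ω - m i)) ^ 2 ∂P
      = variance (∑ i ∈ Finset.range N, ξ i) P := by
    rw [variance_eq_integral hsum.aemeasurable, hmean]
    simp only [Finset.sum_apply, Finset.sum_sub_distrib]
  rw [hvar, IndepFun.variance_sum (fun i _ => hξ i) fun i _ j _ hij => hind.indepFun hij]
  refine Finset.sum_le_sum fun i _ => ?_
  exact variance_le_expectation_sq (hξ i).aestronglyMeasurable

theorem iIndepFun_comp_path {e : ℕ → ℤ → Ω → ℝ} (h : iIndepFun (fun i ω (t : ℤ) => e i t ω) P)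
    {f : ℕ → (ℤ → ℝ) → ℝ} (hf : ∀ i, Measurable (f i)) :
    iIndepFun (fun i ω => f i fun t => e i t ω) P :=
  h.comp f hf

theorem measurable_pathBridge (T t : ℕ) : Measurable (pathBridge T t) := by
  unfold pathBridge
  fun_prop

theorem integral_bridge {Y : ℤ → Ω → ℝ} (h : ∀ t, Integrable (Y t) P ∧ ∫ ω, Y t ω ∂P = 0)
    (T t : ℕ) : ∫ ω, bridge Y T t ω ∂P = 0 := by
  have hi : ∀ t, Integrable (partialSum Y t) P := fun t =>
    integrable_finsetSum _ fun s _ => (h s).1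
  have h₀ : ∀ t, ∫ ω, partialSum Y t ω ∂P = 0 := fun t => by
    simp only [partialSum]
    rw [integral_finsetSum _ fun (s : ℕ) _ => (h (s : ℤ)).1]
    exact Finset.sum_eq_zero fun s _ => (h s).2
  simp only [bridge]
  rw [integral_sub (hi t) ((hi T).const_mul _), integral_const_mul, h₀, h₀]
  ring

theorem weightedBridge_integrable {e : ℕ → ℤ → Ω → ℝ} (hL : ∀ i t, MemLp (e i t) 2 P)
    (w : ℕ → ℝ) (N T a b : ℕ) :
    Integrable (fun ω => (weightedBridge e w N T b ω - weightedBridge e w N T a ω) ^ 2) P := by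
  have h : ∀ t, MemLp (weightedBridge e w N T t) 2 P := fun t =>
    memLp_finsetSum _ fun i _ => (memLp_bridge (hL i) T t).const_mul _
  exact ((h b).sub (h a)).integrable_sq

theorem weightedBridge_increment [IsProbabilityMeasure P] {e : ℕ → ℤ → Ω → ℝ}
    (hind : iIndepFun (fun i ω (t : ℤ) => e i t ω) P)
    (hs : ∀ i, StrictlyStationary P (e i)) (hL : ∀ i t, MemLp (e i t) 2 P)
    (h₀ : ∀ i t, Integrable (e i t) P ∧ ∫ ω, e i t ω ∂P = 0) {c : ℝ}
    (hc : ∀ i (t : ℕ), ∫ ω, partialSum (e i) t ω ^ 2 ∂P ≤ c * t) (w : ℕ → ℝ) (N : ℕ)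
    {T a b : ℕ} (hab : a ≤ b) (hb : b ≤ T) :
    ∫ ω, (weightedBridge e w N T b ω - weightedBridge e w N T a ω) ^ 2 ∂P
      ≤ 4 * c * (∑ i ∈ Finset.range N, w i * w i) * ((b : ℝ) - a) := by
  have hξ : ∀ i, MemLp (fun ω => w i * (bridge (e i) T b ω - bridge (e i) T a ω)) 2 P := fun i =>
    ((memLp_bridge (hL i) T b).sub (memLp_bridge (hL i) T a)).const_mul _
  have hi : iIndepFun (fun i ω => w i * (bridge (e i) T b ω - bridge (e i) T a ω)) P :=
    iIndepFun_comp_path hind (f := fun i y => w i * (pathBridge T b y - pathBridge T a y))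
      fun i => ((measurable_pathBridge T b).sub (measurable_pathBridge T a)).const_mul _
  have hm : ∀ i, ∫ ω, w i * (bridge (e i) T b ω - bridge (e i) T a ω) ∂P = 0 := fun i => by
    rw [integral_const_mul, integral_sub ((memLp_bridge (hL i) T b).integrable (by norm_num))
      ((memLp_bridge (hL i) T a).integrable (by norm_num)), integral_bridge (h₀ i),
      integral_bridge (h₀ i)]
    ring
  have h := integral_sum_centered_sq_le hξ hi hm N
  have e₁ : ∀ ω, weightedBridge e w N T b ω - weightedBridge e w N T a ω
      = ∑ i ∈ Finset.range N, (w i * (bridge (e i) T b ω - bridge (e i) T a ω) - 0) := fun ω => by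
    simp only [weightedBridge, ← Finset.sum_sub_distrib, sub_zero, mul_sub]
  simp only [e₁]
  refine h.trans ?_
  rw [Finset.mul_sum, Finset.sum_mul]
  refine Finset.sum_le_sum fun i _ => ?_
  simp only [mul_pow]
  rw [integral_const_mul]
  calc w i ^ 2 * ∫ ω, (bridge (e i) T b ω - bridge (e i) T a ω) ^ 2 ∂P
      ≤ w i ^ 2 * (4 * c * ((b : ℝ) - a)) := by
        gcongr
        exact integral_bridge_sub_sq_le (hs i) (hL i) (hc i) hab hb
    _ = _ := by ring

theorem squaredBridge_integrable [IsProbabilityMeasure P] {e : ℕ → ℤ → Ω → ℝ}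
    (hL : ∀ i t, MemLp (e i t) 4 P) (v : ℕ → ℝ) (N T a b : ℕ) :
    Integrable (fun ω => (squaredBridge e v N T b ω - squaredBridge e v N T a ω) ^ 2) P := by
  simp only [squaredBridge_sub]
  have h : MemLp (fun ω => ∑ i ∈ Finset.range N,
      ((bridge (e i) T b ω ^ 2 - bridge (e i) T a ω ^ 2)
        - (v i * (b - (b : ℝ) ^ 2 / T) - v i * (a - (a : ℝ) ^ 2 / T)))) 2 P :=
    memLp_finsetSum _ fun i _ => (memLp_bridge_sq_sub (hL i) T a b).sub (memLp_const _)
  exact h.integrable_sq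

/-- The exact centering makes the increments mean zero, so only `N` terms of order `T (b - a)` are
added. The constant is `4 + 4 + (27/2) · 18 = 251`. -/
theorem squaredBridge_increment [IsProbabilityMeasure P] {e : ℕ → ℤ → Ω → ℝ}
    (hind : iIndepFun (fun i ω (t : ℤ) => e i t ω) P)
    (hs : ∀ i, StrictlyStationary P (e i)) (hL : ∀ i t, MemLp (e i t) 4 P) {v : ℕ → ℝ}
    (hv : ∀ i (t : ℕ), ∫ ω, partialSum (e i) t ω ^ 2 ∂P = v i * t) {N : ℕ} {C : ℝ}
    (hC : ∀ t : ℕ, ∑ i ∈ Finset.range N, ∫ ω, partialSum (e i) t ω ^ 4 ∂P ≤ C * N * t ^ 2)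
    {T a b : ℕ} (hab : a ≤ b) (hb : b ≤ T) :
    ∫ ω, (squaredBridge e v N T b ω - squaredBridge e v N T a ω) ^ 2 ∂P
      ≤ 251 * C * (N * T) * ((b : ℝ) - a) := by
  rcases hab.eq_or_lt with rfl | hab'
  · simp
  have hL₂ : ∀ i t, MemLp (e i t) 2 P := fun i t => (hL i t).mono_exponent (by norm_num)
  have hi : iIndepFun (fun i ω => bridge (e i) T b ω ^ 2 - bridge (e i) T a ω ^ 2) P :=
    iIndepFun_comp_path hind (f := fun i y => pathBridge T b y ^ 2 - pathBridge T a y ^ 2)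
      fun i => ((measurable_pathBridge T b).pow_const 2).sub
        ((measurable_pathBridge T a).pow_const 2)
  have hm : ∀ i, ∫ ω, (bridge (e i) T b ω ^ 2 - bridge (e i) T a ω ^ 2) ∂P
      = v i * (b - (b : ℝ) ^ 2 / T) - v i * (a - (a : ℝ) ^ 2 / T) := fun i => by
    rw [integral_sub (memLp_bridge (hL₂ i) T b).integrable_sq
      (memLp_bridge (hL₂ i) T a).integrable_sq, integral_bridge_sq (hs i) (hL₂ i) (hv i) hb,
      integral_bridge_sq (hs i) (hL₂ i) (hv i) (hab.trans hb)]
  have h := integral_sum_centered_sq_le (fun i => memLp_bridge_sq_sub (hL i) T a b) hi hm N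
  simp only [squaredBridge_sub]
  refine h.trans ((Finset.sum_le_sum fun i _ =>
    integral_bridge_sq_sub_sq_le (hs i) (hL i) hab' hb).trans ?_)
  simp only [Finset.sum_add_distrib, ← Finset.mul_sum]
  have hk : (0 : ℝ) < (b : ℝ) - a := by simpa using hab'
  have hT : (0 : ℝ) < T := by exact_mod_cast (by omega : 0 < T)
  have hbT : (b : ℝ) ≤ T := by exact_mod_cast hb
  have haT : (a : ℝ) ≤ T := by exact_mod_cast hab.trans hb
  have hkT : (b : ℝ) - a ≤ T := by linarith [Nat.cast_nonneg (α := ℝ) a]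
  have hCN : 0 ≤ C * N := by
    have h₁ := hC 1
    have h₂ : 0 ≤ ∑ i ∈ Finset.range N, ∫ ω, partialSum (e i) 1 ω ^ 4 ∂P :=
      Finset.sum_nonneg fun i _ => integral_nonneg fun ω => by positivity
    simpa using h₂.trans h₁
  have hCb : ∑ i ∈ Finset.range N, ∫ ω, partialSum (e i) b ω ^ 4 ∂P ≤ C * N * T ^ 2 :=
    (hC b).trans (by gcongr)
  have hCa : ∑ i ∈ Finset.range N, ∫ ω, partialSum (e i) a ω ^ 4 ∂P ≤ C * N * T ^ 2 :=
    (hC a).trans (by gcongr)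
  have hCk := hC (b - a)
  rw [Nat.cast_sub hab] at hCk
  set k : ℝ := (b : ℝ) - a
  calc _ ≤ T / k * (4 * (C * N * k ^ 2 + (k / T) ^ 4 * (C * N * T ^ 2)))
        + k / T * (27 / 2 * (C * N * T ^ 2 + C * N * T ^ 2 + 16 * (C * N * T ^ 2))) := by
        gcongr
        · exact hC T
        · exact hC T
    _ = C * N * T * k * (4 + 4 * (k / T) ^ 2 + 243) := by
        field_simp
        ring
    _ ≤ C * N * T * k * 251 := by
        have h₁ : k / T ≤ 1 := (div_le_one hT).2 hkT
        have h₂ : (k / T) ^ 2 ≤ 1 := pow_le_one₀ (by positivity) h₁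
        refine mul_le_mul_of_nonneg_left ?_ (by positivity)
        linarith
    _ = _ := by ring

end Independence

/-! ### Consequences of the moment assumptions -/

section Moments

variable {Ω : Type*} [MeasurableSpace Ω] {P : Measure Ω}

theorem ErrorMoments.memLp_four [IsProbabilityMeasure P] {e : ℕ → ℤ → Ω → ℝ}
    (h : ErrorMoments P e) (i : ℕ) (t : ℤ) : MemLp (e i t) 4 P := by
  obtain ⟨κ, hκ, hL, -⟩ := h.higher
  refine (hL i t).mono_exponent ?_
  rw [show (4 : ENNReal) = ENNReal.ofReal 4 by simp]
  exact ENNReal.ofReal_le_ofReal hκ.le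

/-- For fixed `i` and `t` the quantity inside the suprema does not involve `N, T`, yet it is bounded
by something tending to zero. Hence it vanishes, and the variance is exactly `σ_i² t`. -/
theorem ErrorMoments.exists_second {e : ℕ → ℤ → Ω → ℝ} (h : ErrorMoments P e) :
    ∃ (v : ℕ → ℝ) (c : ℝ), 0 < c ∧ (∀ i, 0 ≤ v i ∧ v i ≤ c) ∧
      ∀ i (t : ℕ), ∫ ω, partialSum (e i) t ω ^ 2 ∂P = v i * t := by
  obtain ⟨σ, C₁, C₂, hC₁, hC, hσ, ho⟩ := h.second
  refine ⟨fun i => σ i ^ 2, C₂ ^ 2, by have := hC₁.trans_le hC; positivity,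
    fun i => ⟨sq_nonneg _, pow_le_pow_left₀ (hC₁.le.trans (hσ i).1) (hσ i).2 2⟩, ?_⟩
  intro i t
  rcases Nat.eq_zero_or_pos t with rfl | ht
  · simp
  have ht' : (0 : ℝ) < t := by exact_mod_cast ht
  have hzero : |1 / (t : ℝ) * longRunMoment P (e i) 2 t - σ i ^ 2| ≤ 0 := by
    refine le_of_forall_pos_le_add fun ε hε => ?_
    rw [zero_add]
    -- Panel `i` and time `t` enter the suprema once `N ≥ i + 1` and `T ≥ t`.
    have hev := (isLittleO_iff.1 ho hε).and (eventually_ge_atTop (i + 1, t))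
    obtain ⟨p, hp, hip⟩ := hev.exists
    have hi : i < p.1 := hip.1
    have htp : t ≤ p.2 := hip.2
    rw [norm_one, mul_one] at hp
    refine le_trans ?_ ((le_abs_self _).trans hp)
    exact le_ciSup_of_le (Set.finite_range _).bddAbove ⟨i, hi⟩
      (le_ciSup_of_le (Set.finite_range _).bddAbove ⟨t, ht, htp⟩ le_rfl)
  have heq := sub_eq_zero.1 (abs_nonpos_iff.1 hzero)
  have hm : longRunMoment P (e i) 2 t = ∫ ω, partialSum (e i) t ω ^ 2 ∂P := by
    simp only [longRunMoment, Real.rpow_two, sq_abs]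
  rw [← hm]
  beta_reduce
  rw [← heq]
  field_simp

/-- After scaling by `√t`, `y⁴ ≤ 1 + y^κ` reduces the fourth moment to the one of order `κ`; then `1
+ u ≤ 2 + u²` brings in the averaged squares that the assumption controls. -/
theorem ErrorMoments.exists_fourth [IsProbabilityMeasure P] {e : ℕ → ℤ → Ω → ℝ}
    (h : ErrorMoments P e) :
    ∃ C : ℝ, 0 < C ∧ ∀ᶠ N : ℕ in atTop, ∀ t : ℕ,
      ∑ i ∈ Finset.range N, ∫ ω, partialSum (e i) t ω ^ 4 ∂P ≤ C * N * t ^ 2 := by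
  have hL₄ := h.memLp_four
  obtain ⟨κ, hκ, hL, hO⟩ := h.higher
  obtain ⟨C, hC, hb⟩ := hO.exists_pos
  rw [isBigOWith_iff] at hb
  obtain ⟨⟨N₀, T₀⟩, hN⟩ := eventually_atTop.1 hb
  refine ⟨2 + C, by positivity, ?_⟩
  filter_upwards [eventually_ge_atTop N₀, eventually_gt_atTop 0] with N hN₀ hNpos t
  rcases Nat.eq_zero_or_pos t with rfl | ht
  · simp
  have ht' : (0 : ℝ) < t := by exact_mod_cast ht
  have hNpos' : (0 : ℝ) < N := by exact_mod_cast hNpos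
  set u : ℕ → ℝ := fun i => 1 / (t : ℝ) ^ (κ / 2) * longRunMoment P (e i) κ t with hu
  have hsq : ∑ i ∈ Finset.range N, u i ^ 2 ≤ C * N := by
    -- The errors do not depend on `T`, so the horizon may be enlarged to contain `t`. The bound
    -- thus holds for every `t` with a threshold on `N` alone.
    have h₁ := hN (N, max T₀ t) ⟨hN₀, le_max_left _ _⟩
    rw [norm_one, mul_one] at h₁
    have h₂ := (le_abs_self _).trans h₁
    simp only at h₂
    rw [one_div, inv_mul_le_iff₀ hNpos', mul_comm] at h₂
    refine le_trans ?_ h₂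
    exact le_ciSup_of_le (f := fun s : Set.Icc 1 (max T₀ t) => ∑ i ∈ Finset.range N,
      (1 / ((s : ℕ) : ℝ) ^ (κ / 2) * longRunMoment P (e i) κ s) ^ 2)
      (Set.finite_range _).bddAbove ⟨t, ht, le_max_right _ _⟩ le_rfl
  have hfour : ∀ i, ∫ ω, partialSum (e i) t ω ^ 4 ∂P ≤ (1 + u i) * t ^ 2 := by
    intro i
    have hiκ : Integrable (fun ω => |partialSum (e i) t ω| ^ κ) P := by
      have := (memLp_partialSum (hL i) t).integrable_norm_rpow
        (by simp; linarith) (by simp)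
      rwa [ENNReal.toReal_ofReal (by linarith)] at this
    have hi : Integrable (fun ω => (t : ℝ) ^ 2 * (1 / (t : ℝ) ^ (κ / 2)
        * |partialSum (e i) t ω| ^ κ)) P := (hiκ.const_mul _).const_mul _
    have hic : Integrable (fun _ : Ω => (t : ℝ) ^ 2) P := integrable_const _
    calc ∫ ω, partialSum (e i) t ω ^ 4 ∂P
        ≤ ∫ ω, ((t : ℝ) ^ 2 + (t : ℝ) ^ 2 * (1 / (t : ℝ) ^ (κ / 2)
            * |partialSum (e i) t ω| ^ κ)) ∂P := by
          refine integral_mono (memLp_four_integrable (memLp_partialSum (hL₄ i) t))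
            (hic.add hi) fun ω => ?_
          set y := |partialSum (e i) t ω| / √t with hy
          have hst : 0 < √(t : ℝ) := Real.sqrt_pos.2 ht'
          have hy₀ : 0 ≤ y := by positivity
          have h₁ : y ^ 4 ≤ 1 + y ^ κ := by
            rcases le_total y 1 with hy₁ | hy₁
            · have : y ^ 4 ≤ 1 := pow_le_one₀ hy₀ hy₁
              have : 0 ≤ y ^ κ := by positivity
              linarith
            · have := Real.rpow_le_rpow_of_exponent_le hy₁ hκ.le
              rw [show (4 : ℝ) = ((4 : ℕ) : ℝ) by norm_num, Real.rpow_natCast] at this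
              linarith
          have h₂ : y ^ κ = 1 / (t : ℝ) ^ (κ / 2) * |partialSum (e i) t ω| ^ κ := by
            rw [hy, Real.div_rpow (abs_nonneg _) hst.le, Real.sqrt_eq_rpow,
              ← Real.rpow_mul ht'.le, show 1 / 2 * κ = κ / 2 by ring]
            ring
          have h₃ : partialSum (e i) t ω ^ 4 = (t : ℝ) ^ 2 * y ^ 4 := by
            rw [hy, div_pow, Even.pow_abs (by decide), show √(t : ℝ) ^ 4 = (√(t : ℝ) ^ 2) ^ 2 by ring,
              Real.sq_sqrt ht'.le]
            field_simp
          simp only [h₃]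
          rw [← h₂]
          nlinarith [sq_nonneg (t : ℝ)]
      _ = (1 + u i) * t ^ 2 := by
          rw [integral_add hic hi, integral_const_mul, integral_const_mul]
          simp only [integral_const, probReal_univ, one_smul, hu, longRunMoment]
          ring
  calc ∑ i ∈ Finset.range N, ∫ ω, partialSum (e i) t ω ^ 4 ∂P
      ≤ ∑ i ∈ Finset.range N, (2 + u i ^ 2) * (t : ℝ) ^ 2 := by
        refine Finset.sum_le_sum fun i _ => (hfour i).trans ?_
        refine mul_le_mul_of_nonneg_right ?_ (sq_nonneg _)
        nlinarith [sq_nonneg (u i - 1)]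
    _ = (2 * N + ∑ i ∈ Finset.range N, u i ^ 2) * (t : ℝ) ^ 2 := by
        rw [← Finset.sum_mul, Finset.sum_add_distrib]
        simp [mul_comm]
    _ ≤ (2 * N + C * N) * (t : ℝ) ^ 2 := by gcongr
    _ = _ := by ring

theorem FactorMoments.memLp_two [IsProbabilityMeasure P] {η : ℤ → Ω → ℝ}
    (h : FactorMoments P η) (t : ℤ) : MemLp (η t) 2 P := by
  obtain ⟨κ, hκ, hL, -⟩ := h.higher
  refine (hL t).mono_exponent ?_
  rw [show (2 : ENNReal) = ENNReal.ofReal 2 by simp]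
  exact ENNReal.ofReal_le_ofReal hκ.le

/-- Beyond some `t₁` the second moment is at most `2 t`; the finitely many earlier ones are absorbed
by adding them to the constant. -/
theorem FactorMoments.exists_second {η : ℤ → Ω → ℝ} (h : FactorMoments P η) :
    ∃ c : ℝ, 0 < c ∧ ∀ t : ℕ, ∫ ω, partialSum η t ω ^ 2 ∂P ≤ c * t := by
  obtain ⟨t₁, ht₁⟩ := eventually_atTop.1 (isLittleO_iff.1 h.second one_pos)
  have hn : ∀ t : ℕ, 0 ≤ ∫ ω, partialSum η t ω ^ 2 ∂P := fun t =>
    integral_nonneg fun ω => sq_nonneg _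
  refine ⟨2 + ∑ s ∈ Finset.range t₁, ∫ ω, partialSum η s ω ^ 2 ∂P,
    add_pos_of_pos_of_nonneg two_pos (Finset.sum_nonneg fun s _ => hn s), fun t => ?_⟩
  have hsum := Finset.sum_nonneg (s := Finset.range t₁) fun s _ => hn s
  rcases Nat.eq_zero_or_pos t with rfl | ht
  · simp
  have ht' : (1 : ℝ) ≤ t := by exact_mod_cast ht
  rcases lt_or_ge t t₁ with hlt | hge
  · have := Finset.single_le_sum (s := Finset.range t₁) (fun s _ => hn s) (Finset.mem_range.2 hlt)
    nlinarith
  · have := (le_abs_self _).trans (ht₁ t hge)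
    rw [one_mul, Real.norm_of_nonneg (by positivity)] at this
    nlinarith

end Moments

/-! ### Splitting the CUSUM into signal and noise -/

section Decomposition

/-- The bridge of the step function `1{t > t₀}`. -/
noncomputable def stepBridge (t₀ T t : ℕ) : ℝ :=
  ((t - t₀ : ℕ) : ℝ) - ((t : ℝ) / (T : ℝ)) * ((T - t₀ : ℕ) : ℝ)

theorem abs_stepBridge_le {t₀ T t : ℕ} (hT : 0 < T) (ht : t ≤ T) : |stepBridge t₀ T t| ≤ T := by
  have hT' : (0 : ℝ) < T := by exact_mod_cast hT
  have h₁ : ((t - t₀ : ℕ) : ℝ) ≤ T := by exact_mod_cast (by omega : t - t₀ ≤ T)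
  have h₂ : ((T - t₀ : ℕ) : ℝ) ≤ T := by exact_mod_cast (by omega : T - t₀ ≤ T)
  have h₃ : (t : ℝ) / T ≤ 1 := (div_le_one hT').2 (by exact_mod_cast ht)
  have h₄ : (t : ℝ) / T * ((T - t₀ : ℕ) : ℝ) ≤ 1 * T := by gcongr
  have h₅ : 0 ≤ (t : ℝ) / T * ((T - t₀ : ℕ) : ℝ) := by positivity
  rw [stepBridge, abs_le]
  constructor <;> linarith [Nat.cast_nonneg (α := ℝ) (t - t₀)]

theorem stepBridge_of_le {t₀ T t : ℕ} (ht₀ : t₀ ≤ T) (ht : t ≤ t₀) :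
    stepBridge t₀ T t = -(t * ((T : ℝ) - t₀) / T) := by
  rw [stepBridge, Nat.sub_eq_zero_of_le ht, Nat.cast_sub ht₀]
  push_cast
  ring

theorem stepBridge_of_ge {t₀ T t : ℕ} (hT : 0 < T) (ht₀ : t₀ ≤ T) (ht : t₀ ≤ t) :
    stepBridge t₀ T t = -(t₀ * ((T : ℝ) - t) / T) := by
  have hT' : (T : ℝ) ≠ 0 := by exact_mod_cast hT.ne'
  rw [stepBridge, Nat.cast_sub ht, Nat.cast_sub ht₀]
  field_simp
  ring

theorem abs_stepBridge_sub_le {t₀ T t : ℕ} (hT : 0 < T) (ht₀ : t₀ ≤ T) :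
    |stepBridge t₀ T t - stepBridge t₀ T t₀| ≤ |(t : ℝ) - t₀| := by
  have hT' : (0 : ℝ) < T := by exact_mod_cast hT
  have h₀ : (t₀ : ℝ) ≤ T := by exact_mod_cast ht₀
  rcases le_total t t₀ with h | h
  · rw [stepBridge_of_le ht₀ h, stepBridge_of_le ht₀ le_rfl]
    rw [show -(t * ((T : ℝ) - t₀) / T) - -(t₀ * ((T : ℝ) - t₀) / T)
      = -(((t : ℝ) - t₀) * (((T : ℝ) - t₀) / T)) by ring, abs_neg, abs_mul,
      abs_of_nonneg (div_nonneg (sub_nonneg.2 h₀) hT'.le)]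
    refine mul_le_of_le_one_right (abs_nonneg _) ((div_le_one hT').2 ?_)
    linarith [Nat.cast_nonneg (α := ℝ) t₀]
  · rw [stepBridge_of_ge hT ht₀ h, stepBridge_of_ge hT ht₀ le_rfl]
    rw [show -(t₀ * ((T : ℝ) - t) / T) - -(t₀ * ((T : ℝ) - t₀) / T)
      = ((t : ℝ) - t₀) * (t₀ / T) by ring, abs_mul, abs_of_nonneg (div_nonneg (by positivity) hT'.le)]
    exact mul_le_of_le_one_right (abs_nonneg _) ((div_le_one hT').2 h₀)

/-- On either side of `t₀` the bridge of the step is linear, so the gap factors as a squared slope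
times a difference of squares. The slope is bounded below by `β` on the left and `α` on the right.
-/
theorem stepBridge_sq_sub_sq_ge {t₀ T t : ℕ} {α β : ℝ} (hα : 0 ≤ α) (hα₁ : α ≤ 1) (hβ : 0 ≤ β)
    (hT : 0 < T) (ht : t ≤ T) (h₁ : α * T ≤ t₀) (h₂ : β * T ≤ T - t₀) :
    α ^ 2 * β ^ 2 * (T * |(t : ℝ) - t₀|) ≤ stepBridge t₀ T t₀ ^ 2 - stepBridge t₀ T t ^ 2 := by
  have hT' : (0 : ℝ) < T := by exact_mod_cast hT
  have hβT : 0 ≤ β * T := by positivity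
  have hαT : 0 ≤ α * T := by positivity
  have ht₀ : t₀ ≤ T := by
    have : (t₀ : ℝ) ≤ T := by linarith
    exact_mod_cast this
  have htT : (t : ℝ) ≤ T := by exact_mod_cast ht
  rcases le_total t t₀ with h | h
  · have h' : (t : ℝ) ≤ t₀ := by exact_mod_cast h
    rw [stepBridge_of_le ht₀ h, stepBridge_of_le ht₀ le_rfl, abs_sub_comm,
      abs_of_nonneg (sub_nonneg.2 h')]
    have hb : β ≤ ((T : ℝ) - t₀) / T := (le_div_iff₀ hT').2 h₂
    calc α ^ 2 * β ^ 2 * (T * ((t₀ : ℝ) - t)) = β ^ 2 * ((α ^ 2 * T) * ((t₀ : ℝ) - t)) := by ring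
      _ ≤ (((T : ℝ) - t₀) / T) ^ 2 * ((t₀ + t) * ((t₀ : ℝ) - t)) := by
        have : α ^ 2 * T ≤ t₀ + t := by nlinarith [Nat.cast_nonneg (α := ℝ) t]
        have := sub_nonneg.2 h'
        gcongr
      _ = _ := by ring
  · have h' : (t₀ : ℝ) ≤ t := by exact_mod_cast h
    rw [stepBridge_of_ge hT ht₀ h, stepBridge_of_ge hT ht₀ le_rfl,
      abs_of_nonneg (sub_nonneg.2 h')]
    have ha : α ≤ (t₀ : ℝ) / T := (le_div_iff₀ hT').2 h₁
    calc α ^ 2 * β ^ 2 * (T * ((t : ℝ) - t₀)) = α ^ 2 * ((β ^ 2 * T) * ((t : ℝ) - t₀)) := by ring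
      _ ≤ ((t₀ : ℝ) / T) ^ 2 * ((((T : ℝ) - t₀) + (T - t)) * ((t : ℝ) - t₀)) := by
        have : β ^ 2 * T ≤ ((T : ℝ) - t₀) + (T - t) := by nlinarith
        have := sub_nonneg.2 h'
        gcongr
      _ = _ := by ring

theorem sum_ite_lt (t₀ t : ℕ) :
    ∑ s ∈ Finset.Icc 1 t, (if (t₀ : ℤ) < (s : ℤ) then (1 : ℝ) else 0) = ((t - t₀ : ℕ) : ℝ) := by
  induction t with
  | zero => simp
  | succ t ih =>
    rw [Finset.sum_Icc_succ_top (by omega), ih]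
    by_cases h : t₀ < t + 1
    · rw [if_pos (by exact_mod_cast h), show t + 1 - t₀ = (t - t₀) + 1 by omega]
      push_cast
      ring
    · rw [if_neg (by exact_mod_cast h), show t + 1 - t₀ = 0 by omega, show t - t₀ = 0 by omega]
      simp

variable {Ω : Type*}

theorem bridge_panelObs (μ : ℕ → ℝ) (δ γ : ℕ → ℕ → ℕ → ℝ) (θ : ℝ) (η : ℤ → Ω → ℝ)
    (e : ℕ → ℤ → Ω → ℝ) (N : ℕ) {T : ℕ} (hT : 0 < T) (i t : ℕ) (ω : Ω) :
    bridge (panelObs μ δ γ θ η e N T i) T t ω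
      = δ N T i * stepBridge (changePoint θ T) T t + γ N T i * bridge η T t ω
        + bridge (e i) T t ω := by
  have hT' : (T : ℝ) ≠ 0 := by exact_mod_cast hT.ne'
  have h : ∀ t : ℕ, partialSum (panelObs μ δ γ θ η e N T i) t ω
      = t * μ i + δ N T i * ((t - changePoint θ T : ℕ) : ℝ) + γ N T i * partialSum η t ω
        + partialSum (e i) t ω := fun t => by
    simp only [partialSum, panelObs, Finset.sum_add_distrib, ← Finset.mul_sum, sum_ite_lt]
    simp
  simp only [bridge, h, stepBridge]
  field_simp
  ring

/-- Expanding the square of signal, factor and error gives six terms; the square of the error is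
centered, which adds the explicit mean as a seventh. -/
theorem cusum_panelObs (μ : ℕ → ℝ) (δ γ : ℕ → ℕ → ℕ → ℝ) (θ : ℝ) (η : ℤ → Ω → ℝ)
    (e : ℕ → ℤ → Ω → ℝ) (v : ℕ → ℝ) (N : ℕ) {T : ℕ} (hT : 0 < T) (t : ℕ) (ω : Ω) :
    cusum (panelObs μ δ γ θ η e N T) N T t ω
      = changeSize δ (N, T) * stepBridge (changePoint θ T) T t ^ 2
        + 2 * crossSum δ γ (N, T) * (stepBridge (changePoint θ T) T t * bridge η T t ω)
        + 2 * (stepBridge (changePoint θ T) T t * weightedBridge e (δ N T) N T t ω)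
        + loadingSize γ (N, T) * bridge η T t ω ^ 2
        + 2 * (bridge η T t ω * weightedBridge e (γ N T) N T t ω)
        + squaredBridge e v N T t ω
        + (∑ i ∈ Finset.range N, v i) * (t - (t : ℝ) ^ 2 / T) := by
  have h : cusum (panelObs μ δ γ θ η e N T) N T t ω
      = ∑ i ∈ Finset.range N, bridge (panelObs μ δ γ θ η e N T i) T t ω ^ 2 := rfl
  rw [h]
  simp only [bridge_panelObs μ δ γ θ η e N hT, changeSize, loadingSize, crossSum, weightedBridge,
    squaredBridge, Finset.sum_mul, Finset.mul_sum, ← Finset.sum_add_distrib]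
  exact Finset.sum_congr rfl fun i _ => by ring

/-- The comparison of the CUSUM at `t` with its value at `t₀` at distance `k`. -/
theorem quadratic_comparison {Δ Γ S g g₀ H H₀ Y Y₀ G G₀ V V₀ m m₀ k T τ r d q n c c₀ : ℝ}
    (hΓ : 0 ≤ Γ) (hΓq : Γ ≤ q ^ 2) (hq : 1 ≤ q) (hk : 0 < k) (hτ : 1 ≤ τ) (hT : T = τ ^ 2)
    (hr : 0 ≤ r) (hd : 0 ≤ d) (hΔ : 0 ≤ Δ)
    (hgap : c₀ * (T * k) ≤ g₀ ^ 2 - g ^ 2) (hg : |g| ≤ T) (hgg : |g - g₀| ≤ k)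
    (hH₀ : |H₀| ≤ r * τ) (hH : |H - H₀| ≤ r * k) (hHs : (H - H₀) ^ 2 ≤ r ^ 2 * (k * τ))
    (hY₀ : |Y₀| ≤ r * d * τ) (hY : |Y - Y₀| ≤ r * d * k)
    (hG₀ : |G₀| ≤ r * q * τ) (hG : |G - G₀| ≤ r * q * k)
    (hGs : (G - G₀) ^ 2 ≤ r ^ 2 * q ^ 2 * (k * τ))
    (hV : |V - V₀| ≤ r * n * τ * k) (hm : |m - m₀| ≤ c * k)
    (hsmall : 4 * |S| * r * T + 4 * r * d * T + 9 * r ^ 2 * q ^ 2 * τ + r * n * τ + c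
      < c₀ * (Δ * T)) :
    Δ * g ^ 2 + 2 * S * (g * H) + 2 * (g * Y) + Γ * H ^ 2 + 2 * (H * G) + V + m
      < Δ * g₀ ^ 2 + 2 * S * (g₀ * H₀) + 2 * (g₀ * Y₀) + Γ * H₀ ^ 2 + 2 * (H₀ * G₀) + V₀ + m₀ := by
  have hτT : τ ≤ T := by nlinarith
  have hT₀ : 0 ≤ T := by nlinarith
  have hτ₀ : 0 ≤ τ := by linarith
  have hq₀ : 0 ≤ q := by linarith
  -- Each of the following bounds is a coefficient times `k`, obtained by expanding a product around
  -- its value at `t₀`; `hsmall` multiplied by `k` then adds them up.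
  have b₁ : Δ * (g ^ 2 - g₀ ^ 2) ≤ -(c₀ * (Δ * T) * k) := by
    have := mul_le_mul_of_nonneg_left hgap hΔ
    linarith
  have b₂ : 2 * S * (g * H - g₀ * H₀) ≤ 4 * |S| * r * T * k := by
    have h : |g * (H - H₀) + (g - g₀) * H₀| ≤ 2 * r * T * k := by
      calc |g * (H - H₀) + (g - g₀) * H₀| ≤ |g| * |H - H₀| + |g - g₀| * |H₀| := by
            rw [← abs_mul, ← abs_mul]; exact abs_add_le _ _
        _ ≤ T * (r * k) + k * (r * T) := by gcongr; exact hH₀.trans (by gcongr)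
        _ = _ := by ring
    calc 2 * S * (g * H - g₀ * H₀) = 2 * (S * (g * (H - H₀) + (g - g₀) * H₀)) := by ring
      _ ≤ 2 * (|S| * |g * (H - H₀) + (g - g₀) * H₀|) := by
        rw [← abs_mul]; gcongr; exact le_abs_self _
      _ ≤ 2 * (|S| * (2 * r * T * k)) := by gcongr
      _ = _ := by ring
  have b₃ : 2 * (g * Y - g₀ * Y₀) ≤ 4 * r * d * T * k := by
    calc 2 * (g * Y - g₀ * Y₀) = 2 * (g * (Y - Y₀) + (g - g₀) * Y₀) := by ring
      _ ≤ 2 * (|g| * |Y - Y₀| + |g - g₀| * |Y₀|) := by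
        rw [← abs_mul, ← abs_mul]
        gcongr <;> exact le_abs_self _
      _ ≤ 2 * (T * (r * d * k) + k * (r * d * T)) := by gcongr; exact hY₀.trans (by gcongr)
      _ = _ := by ring
  have b₄ : Γ * (H ^ 2 - H₀ ^ 2) ≤ 3 * r ^ 2 * q ^ 2 * τ * k := by
    have h : H ^ 2 - H₀ ^ 2 ≤ 3 * r ^ 2 * τ * k := by
      calc H ^ 2 - H₀ ^ 2 = 2 * (H₀ * (H - H₀)) + (H - H₀) ^ 2 := by ring
        _ ≤ 2 * (|H₀| * |H - H₀|) + (H - H₀) ^ 2 := by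
          rw [← abs_mul]; gcongr; exact le_abs_self _
        _ ≤ 2 * (r * τ * (r * k)) + r ^ 2 * (k * τ) := by gcongr
        _ = _ := by ring
    calc Γ * (H ^ 2 - H₀ ^ 2) ≤ Γ * (3 * r ^ 2 * τ * k) := by gcongr
      _ ≤ q ^ 2 * (3 * r ^ 2 * τ * k) := by gcongr
      _ = _ := by ring
  have b₅ : 2 * (H * G - H₀ * G₀) ≤ 6 * r ^ 2 * q ^ 2 * τ * k := by
    calc 2 * (H * G - H₀ * G₀)
        = 2 * (H₀ * (G - G₀)) + 2 * ((H - H₀) * G₀) + 2 * (H - H₀) * (G - G₀) := by ring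
      _ ≤ 2 * (|H₀| * |G - G₀|) + 2 * (|H - H₀| * |G₀|) + ((H - H₀) ^ 2 + (G - G₀) ^ 2) := by
        rw [← abs_mul, ← abs_mul]
        gcongr
        · exact le_abs_self _
        · exact le_abs_self _
        · exact two_mul_le_add_sq _ _
      _ ≤ 2 * (r * τ * (r * q * k)) + 2 * (r * k * (r * q * τ))
          + (r ^ 2 * (k * τ) + r ^ 2 * q ^ 2 * (k * τ)) := by gcongr
      _ = r ^ 2 * τ * k * (4 * q + 1 + q ^ 2) := by ring
      -- Here `q ≥ 1` absorbs `4 q + 1`; this is one reason for taking `q² = Γ + 1` in the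
      -- application.
      _ ≤ r ^ 2 * τ * k * (6 * q ^ 2) := by
        gcongr
        nlinarith
      _ = _ := by ring
  have b₆ := (le_abs_self _).trans hV
  have b₇ := (le_abs_self _).trans hm
  have b₈ := mul_lt_mul_of_pos_right hsmall hk
  linarith

end Decomposition

/-! ### Comparison of rates -/

section Rates

theorem loadingSize_nonneg (γ : ℕ → ℕ → ℕ → ℝ) (p : ℕ × ℕ) : 0 ≤ loadingSize γ p :=
  show 0 ≤ ∑ i ∈ Finset.range p.1, γ p.1 p.2 i * γ p.1 p.2 i from
    Finset.sum_nonneg fun _ _ => mul_self_nonneg _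

theorem eventually_noise_lt_signal {δ γ : ℕ → ℕ → ℕ → ℝ} (hsize : SizeConditions δ γ)
    (hchange : Tendsto (changeSize δ) atTop atTop)
    (hcross : (fun p : ℕ × ℕ => crossSum δ γ p / changeSize δ p) =o[atTop] (fun _ => (1 : ℝ)))
    {r c c₀ : ℝ} (hr : 0 ≤ r) (hc : 0 ≤ c) (hc₀ : 0 < c₀) :
    ∀ᶠ p : ℕ × ℕ in atTop, 1 ≤ changeSize δ p ∧
      4 * |crossSum δ γ p| * r * p.2 + 4 * r * √(changeSize δ p) * p.2
        + 9 * r ^ 2 * √(loadingSize γ p + 1) ^ 2 * √(p.2 : ℝ) + r * √(p.1 : ℝ) * √(p.2 : ℝ)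
        + c * p.1 < c₀ * (changeSize δ p * p.2) := by
  -- Each rate will be at most `ε Δ T`. The total coefficient is `4 r + 4 r + r` from the linear
  -- terms, `9 r²` twice from `Γ + 1`, and `c` from the drift.
  set A : ℝ := 9 * r + 18 * r ^ 2 + c with hA
  have hA₀ : 0 ≤ A := by positivity
  set ε : ℝ := min 1 (c₀ / (A + 1)) with hε
  have hε₀ : 0 < ε := lt_min one_pos (by positivity)
  have hε₁ : ε ≤ 1 := min_le_left _ _
  have hεA : ε * A < c₀ := by
    have h₁ : ε * (A + 1) ≤ c₀ := (le_div_iff₀ (by positivity)).1 (min_le_right _ _)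
    linarith
  -- The threshold `1 / ε²` is squared because `Δ` and `N / (Δ T)` enter under square roots.
  filter_upwards [hchange.eventually_ge_atTop (1 / ε ^ 2),
    hsize.change.eventually_ge_atTop (1 / ε ^ 2),
    hsize.loading.eventually (gt_mem_nhds hε₀), isLittleO_iff.1 hcross hε₀,
    eventually_ge_atTop (1, 1)] with p hΔ hTΔ hΓ hcr hp
  have hN : (1 : ℝ) ≤ p.1 := by exact_mod_cast hp.1
  have hT : (1 : ℝ) ≤ p.2 := by exact_mod_cast hp.2
  have hinv : 1 ≤ 1 / ε ^ 2 := by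
    rw [le_div_iff₀ (by positivity), one_mul]
    exact pow_le_one₀ hε₀.le hε₁
  have hΔ₁ : 1 ≤ changeSize δ p := hinv.trans hΔ
  refine ⟨hΔ₁, ?_⟩
  have hΓ₀ := loadingSize_nonneg γ p
  set Δ := changeSize δ p
  set Γ := loadingSize γ p
  set T : ℝ := (p.2 : ℝ)
  set N : ℝ := (p.1 : ℝ)
  have hΔ₀ : 0 < Δ := by linarith
  have hT₀ : 0 < T := by linarith
  have hN₀ : 0 < N := by linarith
  have hΔ' : 1 ≤ ε ^ 2 * Δ := by
    rw [div_le_iff₀ (by positivity)] at hΔ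
    linarith
  have hN' : N ≤ ε ^ 2 * (Δ * T) := by
    rw [div_le_div_iff₀ (by positivity) hN₀] at hTΔ
    linarith
  have hcr' : |crossSum δ γ p| ≤ ε * Δ := by
    rw [norm_one, mul_one, Real.norm_eq_abs, abs_div, abs_of_pos hΔ₀, div_le_iff₀ hΔ₀] at hcr
    exact hcr
  have hd : √Δ ≤ ε * Δ := by
    rw [Real.sqrt_le_left (by positivity)]
    nlinarith
  have hτ : √T ≤ T := by
    rw [Real.sqrt_le_left hT₀.le]
    nlinarith
  have hΓ' : Γ * √T ≤ ε * (Δ * T) := by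
    rw [← Real.sqrt_eq_rpow, div_lt_iff₀ (by positivity)] at hΓ
    have hs : √(T * Δ) * √T ≤ Δ * T := by
      rw [Real.sqrt_mul hT₀.le, mul_right_comm, Real.mul_self_sqrt hT₀.le, mul_comm Δ]
      gcongr
      rw [Real.sqrt_le_left hΔ₀.le]
      nlinarith
    calc Γ * √T ≤ ε * √(T * Δ) * √T := by gcongr
      _ = ε * (√(T * Δ) * √T) := by ring
      _ ≤ _ := by gcongr
  have h₁ : 1 ≤ ε * Δ := by nlinarith
  have hone : √T ≤ ε * (Δ * T) := by nlinarith
  have hNT : √N * √T ≤ ε * (Δ * T) := by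
    rw [← Real.sqrt_mul hN₀.le, Real.sqrt_le_left (by positivity)]
    calc N * T ≤ ε ^ 2 * (Δ * T) * T := by gcongr
      _ ≤ ε ^ 2 * (Δ * T) * (Δ * T) := by
        gcongr
        nlinarith
      _ = _ := by ring
  have hN'' : N ≤ ε * (Δ * T) := hN'.trans (by gcongr; nlinarith)
  rw [Real.sq_sqrt (by linarith)]
  calc 4 * |crossSum δ γ p| * r * T + 4 * r * √Δ * T + 9 * r ^ 2 * (Γ + 1) * √T
        + r * √N * √T + c * N
      = 4 * r * (|crossSum δ γ p| * T) + 4 * r * (√Δ * T)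
        + 9 * r ^ 2 * (Γ * √T + √T) + r * (√N * √T) + c * N := by ring
    _ ≤ 4 * r * (ε * Δ * T) + 4 * r * (ε * Δ * T)
        + 9 * r ^ 2 * (ε * (Δ * T) + ε * (Δ * T)) + r * (ε * (Δ * T)) + c * (ε * (Δ * T)) := by
        gcongr
    _ = ε * A * (Δ * T) := by rw [hA]; ring
    _ < c₀ * (Δ * T) := by gcongr

/-- The two uses of the `k^{3/2}` bound: `√k ≤ k` serves terms linear in the increment, `√k ≤ √T`
serves quadratic ones. -/
theorem abs_le_and_sq_le_of_sq_le {z a k T : ℝ} (ha : 0 ≤ a) (hk : 1 ≤ k) (hkT : k ≤ T)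
    (h : z ^ 2 ≤ a ^ 2 * (k * √k)) : |z| ≤ a * k ∧ z ^ 2 ≤ a ^ 2 * (k * √T) := by
  have hk₀ : 0 ≤ k := by linarith
  refine ⟨abs_le_of_sq_le_sq (h.trans ?_) (by positivity), h.trans ?_⟩
  · rw [mul_pow, sq k]
    gcongr
    rw [Real.sqrt_le_left hk₀]
    nlinarith
  · gcongr

theorem eventually_changePoint {θ : ℝ} (hθ : 0 < θ ∧ θ < 1) :
    ∀ᶠ T : ℕ in atTop, 1 ≤ changePoint θ T ∧ changePoint θ T < T ∧
      θ / 2 * T ≤ changePoint θ T ∧ (1 - θ) * T ≤ T - (changePoint θ T : ℝ) := by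
  -- Once `T θ ≥ 2`, the loss of less than one in the floor costs at most half of `T θ`.
  filter_upwards [(tendsto_natCast_atTop_atTop (R := ℝ)).eventually_ge_atTop (2 / θ)] with T hT
  rw [div_le_iff₀ hθ.1] at hT
  have h₀ : 0 ≤ (T : ℝ) * θ := by linarith
  have h₁ : (changePoint θ T : ℝ) ≤ T * θ := Nat.floor_le h₀
  have h₂ : (T : ℝ) * θ < changePoint θ T + 1 := Nat.lt_floor_add_one _
  have h₃ : (1 : ℝ) ≤ changePoint θ T := by linarith
  refine ⟨by exact_mod_cast h₃, ?_, by linarith, by linarith⟩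
  have : (changePoint θ T : ℝ) < T := by nlinarith
  exact_mod_cast this

end Rates

/-! ### Uniform noise control and consistency -/

section Consistency

variable {Ω : Type*}

/-- The bounds for the noise process `Z` around the time `t₀`, with the scale `a`. -/
def NoiseBounded (Z : ℕ → Ω → ℝ) (t₀ T : ℕ) (a : ℝ) (ω : Ω) : Prop :=
  Z t₀ ω ^ 2 ≤ a * T ∧
    ∀ t ≤ T, (Z t ω - Z t₀ ω) ^ 2 ≤ a * (|(t : ℝ) - t₀| * √|(t : ℝ) - t₀|)

theorem cusum_lt_cusum_changePoint {μ : ℕ → ℝ} {δ γ : ℕ → ℕ → ℕ → ℝ} {η : ℤ → Ω → ℝ}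
    {e : ℕ → ℤ → Ω → ℝ} {θ : ℝ} (hθ : 0 < θ ∧ θ < 1) {v : ℕ → ℝ} {c r : ℝ}
    (hv : ∀ i, 0 ≤ v i ∧ v i ≤ c) (hr : 0 ≤ r) {N T : ℕ} (hT : 0 < T) {ω : Ω}
    (hΔ : 1 ≤ changeSize δ (N, T))
    (hsmall : 4 * |crossSum δ γ (N, T)| * r * T + 4 * r * √(changeSize δ (N, T)) * T
        + 9 * r ^ 2 * √(loadingSize γ (N, T) + 1) ^ 2 * √(T : ℝ) + r * √(N : ℝ) * √(T : ℝ)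
        + c * N < (θ / 2) ^ 2 * (1 - θ) ^ 2 * (changeSize δ (N, T) * T))
    (hlow : θ / 2 * T ≤ changePoint θ T) (hupp : (1 - θ) * T ≤ T - (changePoint θ T : ℝ))
    (hH : NoiseBounded (bridge η T) (changePoint θ T) T (r ^ 2) ω)
    (hY : NoiseBounded (weightedBridge e (δ N T) N T) (changePoint θ T) T
      (r ^ 2 * changeSize δ (N, T)) ω)
    (hG : NoiseBounded (weightedBridge e (γ N T) N T) (changePoint θ T) T
      (r ^ 2 * (loadingSize γ (N, T) + 1)) ω)
    (hV : NoiseBounded (squaredBridge e v N T) (changePoint θ T) T (r ^ 2 * (N * T)) ω)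
    {t : ℕ} (ht : t ≤ T) (hne : t ≠ changePoint θ T) :
    cusum (panelObs μ δ γ θ η e N T) N T t ω
      < cusum (panelObs μ δ γ θ η e N T) N T (changePoint θ T) ω := by
  rw [cusum_panelObs μ δ γ θ η e v N hT, cusum_panelObs μ δ γ θ η e v N hT]
  have hT' : (1 : ℝ) ≤ T := by exact_mod_cast hT
  have hT₀ : (0 : ℝ) ≤ T := by linarith
  have hΔ₀ : 0 ≤ changeSize δ (N, T) := by linarith
  have hΓ := loadingSize_nonneg γ (N, T)
  have ht₀ : changePoint θ T ≤ T := by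
    have : (changePoint θ T : ℝ) ≤ T := by nlinarith [hθ.2]
    exact_mod_cast this
  set t₀ := changePoint θ T
  set k : ℝ := |(t : ℝ) - t₀| with hk
  have htT : (t : ℝ) ≤ T := by exact_mod_cast ht
  have htT₀ : (t₀ : ℝ) ≤ T := by exact_mod_cast ht₀
  have hk₁ : 1 ≤ k := by
    have h : (1 : ℤ) ≤ |(t : ℤ) - t₀| := Int.one_le_abs (sub_ne_zero.2 (by exact_mod_cast hne))
    rw [hk]
    exact_mod_cast h
  have hkT : k ≤ T := by
    rw [hk, abs_le]
    constructor <;> linarith [Nat.cast_nonneg (α := ℝ) t, Nat.cast_nonneg (α := ℝ) t₀]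
  set d := √(changeSize δ (N, T)) with hd
  set q := √(loadingSize γ (N, T) + 1) with hq
  have hd₂ : d ^ 2 = changeSize δ (N, T) := Real.sq_sqrt hΔ₀
  have hq₂ : q ^ 2 = loadingSize γ (N, T) + 1 := Real.sq_sqrt (by linarith)
  have hτ₂ : √(T : ℝ) ^ 2 = T := Real.sq_sqrt hT₀
  have hn₂ : √(N : ℝ) ^ 2 = N := Real.sq_sqrt (Nat.cast_nonneg N)
  have hq₁ : 1 ≤ q := Real.one_le_sqrt.2 (by linarith)
  have hτ₁ : 1 ≤ √(T : ℝ) := Real.one_le_sqrt.2 hT'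
  have hd₀ : 0 ≤ d := Real.sqrt_nonneg _
  obtain ⟨hH₀, hHd⟩ := hH
  obtain ⟨hY₀, hYd⟩ := hY
  obtain ⟨hG₀, hGd⟩ := hG
  obtain ⟨-, hVd⟩ := hV
  rw [← hd₂, ← mul_pow] at hY₀
  rw [← hq₂, ← mul_pow] at hG₀
  have hYt := hYd t ht
  have hGt := hGd t ht
  have hVt := hVd t ht
  rw [← hd₂, ← mul_pow] at hYt
  rw [← hq₂, ← mul_pow] at hGt
  rw [show r ^ 2 * ((N : ℝ) * T) = (r * √(N : ℝ) * √(T : ℝ)) ^ 2 by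
    rw [mul_pow, mul_pow, hn₂, hτ₂]; ring] at hVt
  have bH := abs_le_and_sq_le_of_sq_le hr hk₁ hkT (hHd t ht)
  have bY := abs_le_and_sq_le_of_sq_le (by positivity) hk₁ hkT hYt
  have bG := abs_le_and_sq_le_of_sq_le (by positivity) hk₁ hkT hGt
  have bV := abs_le_and_sq_le_of_sq_le (by positivity) hk₁ hkT hVt
  refine quadratic_comparison (q := q) (d := d) (n := √(N : ℝ)) hΓ (by linarith) hq₁
    (by linarith) hτ₁ hτ₂.symm hr hd₀ hΔ₀ ?_ (abs_stepBridge_le hT ht)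
    (abs_stepBridge_sub_le hT ht₀) ?_ bH.1 bH.2 ?_ bY.1 ?_ bG.1 (by rw [← mul_pow r]; exact bG.2)
    bV.1 ?_ hsmall
  · exact stepBridge_sq_sub_sq_ge (by linarith [hθ.1]) (by linarith [hθ.2]) (by linarith [hθ.2])
      hT ht hlow hupp
  · refine abs_le_of_sq_le_sq ?_ (by positivity)
    rwa [mul_pow, hτ₂]
  · refine abs_le_of_sq_le_sq ?_ (by positivity)
    rwa [mul_pow _ (√(T : ℝ)), hτ₂]
  · refine abs_le_of_sq_le_sq ?_ (by positivity)
    rwa [mul_pow _ (√(T : ℝ)), hτ₂]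
  · have hs₀ : 0 ≤ ∑ i ∈ Finset.range N, v i := Finset.sum_nonneg fun i _ => (hv i).1
    have hs₁ : ∑ i ∈ Finset.range N, v i ≤ c * N := by
      refine (Finset.sum_le_sum fun i _ => (hv i).2).trans (le_of_eq ?_)
      simp [mul_comm]
    have hT₁ : (T : ℝ) ≠ 0 := by positivity
    have e₁ : (∑ i ∈ Finset.range N, v i) * (t - (t : ℝ) ^ 2 / T)
        - (∑ i ∈ Finset.range N, v i) * (t₀ - (t₀ : ℝ) ^ 2 / T)
        = (∑ i ∈ Finset.range N, v i) * (((t : ℝ) - t₀) * (1 - ((t : ℝ) + t₀) / T)) := by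
      field_simp
      ring
    have h₁ : |1 - ((t : ℝ) + t₀) / T| ≤ 1 := by
      have h₂ : ((t : ℝ) + t₀) / T ≤ 2 := by
        rw [div_le_iff₀ (by positivity)]
        linarith
      have h₃ : 0 ≤ ((t : ℝ) + t₀) / T := by positivity
      rw [abs_le]
      constructor <;> linarith
    rw [e₁, abs_mul, abs_mul, abs_of_nonneg hs₀]
    calc (∑ i ∈ Finset.range N, v i) * (|(t : ℝ) - t₀| * |1 - ((t : ℝ) + t₀) / T|)
        ≤ (c * N) * (k * 1) := by
          gcongr
          exact hs₀.trans hs₁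
      _ = _ := by ring

variable [MeasurableSpace Ω] {P : Measure Ω}

/-- A union bound over the four processes. The constants depend on neither `δ`, `γ`, `T` nor `t₀`,
so the level `x` can be fixed before `N` and `T` grow. -/
theorem noise_unbounded_le [IsProbabilityMeasure P] {η : ℤ → Ω → ℝ} {e : ℕ → ℤ → Ω → ℝ}
    (hindep : IndependentStationary P η e) (herror : ErrorMoments P e)
    (hfactor : FactorMoments P η) :
    ∃ (v : ℕ → ℝ) (c K : ℝ), 0 < K ∧ 0 ≤ c ∧ (∀ i, 0 ≤ v i ∧ v i ≤ c) ∧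
      ∀ᶠ N : ℕ in atTop, ∀ (δ γ : ℕ → ℕ → ℕ → ℝ) (T t₀ : ℕ) (x : ℝ), 0 < T → t₀ ≤ T → 0 < x →
        0 < changeSize δ (N, T) →
        P {ω | ¬ (NoiseBounded (bridge η T) t₀ T (x * K) ω ∧
          NoiseBounded (weightedBridge e (δ N T) N T) t₀ T (x * K * changeSize δ (N, T)) ω ∧
          NoiseBounded (weightedBridge e (γ N T) N T) t₀ T
            (x * K * (loadingSize γ (N, T) + 1)) ω ∧
          NoiseBounded (squaredBridge e v N T) t₀ T (x * K * (N * T)) ω)}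
        ≤ 4 * ENNReal.ofReal (515 / x) := by
  obtain ⟨v, c, hc, hv, hv₂⟩ := herror.exists_second
  obtain ⟨C, hC, hfour⟩ := herror.exists_fourth
  obtain ⟨f, hf, hf₂⟩ := hfactor.exists_second
  have hL₄ := herror.memLp_four
  have hL₂ : ∀ i t, MemLp (e i t) 2 P := fun i t => (hL₄ i t).mono_exponent (by norm_num)
  have hη := hfactor.memLp_two
  have hc₂ : ∀ i (t : ℕ), ∫ ω, partialSum (e i) t ω ^ 2 ∂P ≤ c * t := fun i t => by
    rw [hv₂]
    gcongr
    exact (hv i).2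
  set K : ℝ := 4 * f + 4 * c + 251 * C with hK
  have hK₀ : 0 < K := by positivity
  refine ⟨v, c, K, hK₀, hc.le, hv, ?_⟩
  filter_upwards [hfour, eventually_gt_atTop 0] with N hfourN hN δ γ T t₀ x hT ht₀ hx hΔ
  have hT' : (0 : ℝ) < T := by exact_mod_cast hT
  have hN' : (0 : ℝ) < N := by exact_mod_cast hN
  have hΓ := loadingSize_nonneg γ (N, T)
  have hsub : ∀ {a b : ℕ}, a ≤ b → (0 : ℝ) ≤ (b : ℝ) - a := fun hab => by simpa using hab
  have b₁ := measure_increment_bound (P := P) (Z := bridge η T) hK₀ hx hT ht₀ (bridge_zero η T)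
    (fun a b _ _ => ((memLp_bridge hη T b).sub (memLp_bridge hη T a)).integrable_sq)
    fun a b hab hb => (integral_bridge_sub_sq_le hindep.stationary_factor hη hf₂ hab hb).trans
      (mul_le_mul_of_nonneg_right (by linarith) (hsub hab))
  have hw : ∀ (w : ℕ → ℝ) {C' : ℝ}, 0 < C' → ∑ i ∈ Finset.range N, w i * w i ≤ C' →
      P {ω | ¬ NoiseBounded (weightedBridge e w N T) t₀ T (x * K * C') ω}
        ≤ ENNReal.ofReal (515 / x) := fun w C' hC' hle => by
    have := measure_increment_bound (P := P) (Z := weightedBridge e w N T) (C := K * C')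
      (by positivity) hx hT ht₀ (fun ω => by simp [weightedBridge])
      (fun a b _ _ => weightedBridge_integrable hL₂ w N T a b)
      fun a b hab hb => (weightedBridge_increment hindep.indep hindep.stationary_error hL₂
        herror.mean_zero hc₂ w N hab hb).trans
        (mul_le_mul_of_nonneg_right (mul_le_mul (by linarith) hle
          (Finset.sum_nonneg fun i _ => mul_self_nonneg _) hK₀.le) (hsub hab))
    rwa [← mul_assoc] at this
  have b₂ := hw (δ N T) hΔ le_rfl
  -- The loadings may all vanish, so `1` is added to keep the scale positive.
  have b₃ := hw (γ N T) (C' := loadingSize γ (N, T) + 1) (by linarith)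
    (le_add_of_nonneg_right zero_le_one)
  have b₄ := measure_increment_bound (P := P) (Z := squaredBridge e v N T) (C := K * (N * T))
    (by positivity) hx hT ht₀ (fun ω => by simp [squaredBridge])
    (fun a b _ _ => squaredBridge_integrable hL₄ v N T a b)
    fun a b hab hb => (squaredBridge_increment hindep.indep hindep.stationary_error hL₄ hv₂
      hfourN hab hb).trans (mul_le_mul_of_nonneg_right
        (mul_le_mul_of_nonneg_right (by linarith) (by positivity)) (hsub hab))
  rw [← mul_assoc] at b₄
  simp only [not_and_or, Set.ofPred_or]
  calc _ ≤ _ := (measure_union_le _ _).trans (add_le_add b₁ ((measure_union_le _ _).trans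
        (add_le_add b₂ ((measure_union_le _ _).trans (add_le_add b₃ b₄)))))
    _ = _ := by ring

end Consistency

theorem mainTheorem1 {Ω : Type*} [MeasurableSpace Ω] (P : Measure Ω) [IsProbabilityMeasure P]
    (μ : ℕ → ℝ) (δ γ : ℕ → ℕ → ℕ → ℝ) (η : ℤ → Ω → ℝ) (e : ℕ → ℤ → Ω → ℝ)
    (θ : ℝ) (hθ : 0 < θ ∧ θ < 1)
    (hindep : IndependentStationary P η e)
    (herror : ErrorMoments P e)
    (hfactor : FactorMoments P η)
    (hsize : SizeConditions δ γ)
    (hchange : Tendsto (changeSize δ) atTop atTop)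
    (hcross : (fun p : ℕ × ℕ => crossSum δ γ p / changeSize δ p) =o[atTop] (fun _ => (1 : ℝ)))
    (that : ℕ → ℕ → Ω → ℕ)
    (hthat : ∀ N T : ℕ, 2 ≤ T → ∀ ω,
      that N T ω ∈ cusumArgmax (panelObs μ δ γ θ η e N T) N T ω) :
    Tendsto (fun p : ℕ × ℕ => P {ω | that p.1 p.2 ω = changePoint θ p.2}) atTop (𝓝 1) := by
  obtain ⟨v, c, K, hK, hc, hv, hnoise⟩ := noise_unbounded_le hindep herror hfactor
  have hfail : Tendsto (fun p : ℕ × ℕ => P {ω | that p.1 p.2 ω = changePoint θ p.2}ᶜ)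
      atTop (𝓝 0) := by
    rw [ENNReal.tendsto_nhds_zero]
    intro ε hε
    -- First `x` is chosen to make the failure probability small; then `r = √(x K)` is a constant to
    -- which the comparison of rates applies.
    obtain ⟨x, hx, hxε⟩ : ∃ x : ℝ, 0 < x ∧ 4 * ENNReal.ofReal (515 / x) ≤ ε := by
      have h₁ : Tendsto (fun x : ℝ => 4 * ENNReal.ofReal (515 / x)) atTop (𝓝 0) := by
        have h₂ : Tendsto (fun x : ℝ => 515 / x) atTop (𝓝 0) := tendsto_const_nhds.div_atTop tendsto_id
        have h₃ := ENNReal.Tendsto.const_mul (a := 4) (ENNReal.tendsto_ofReal h₂)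
          (Or.inr (by norm_num))
        simpa using h₃
      obtain ⟨x, hx₁, hx₂⟩ := ((ENNReal.tendsto_nhds_zero.1 h₁ ε hε).and
        (eventually_gt_atTop 0)).exists
      exact ⟨x, hx₂, hx₁⟩
    have hr₂ : √(x * K) ^ 2 = x * K := Real.sq_sqrt (by positivity)
    have hθ₁ : 0 < 1 - θ := by linarith [hθ.2]
    have hθ₀ := hθ.1
    have hrates := eventually_noise_lt_signal hsize hchange hcross (r := √(x * K)) (c := c)
      (c₀ := (θ / 2) ^ 2 * (1 - θ) ^ 2) (Real.sqrt_nonneg _) hc (by positivity)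
    rw [← prod_atTop_atTop_eq] at hrates ⊢
    filter_upwards [hrates, tendsto_fst.eventually hnoise,
      tendsto_snd.eventually (eventually_changePoint hθ),
      tendsto_snd.eventually (eventually_ge_atTop 2)] with ⟨N, T⟩ hrate hN hcp hT
    obtain ⟨hΔ, hsmall⟩ := hrate
    obtain ⟨hcp₁, hcp₂, hlow, hupp⟩ := hcp
    refine (measure_mono ?_).trans ((hN δ γ T (changePoint θ T) x (by omega) hcp₂.le hx
      (by linarith)).trans hxε)
    intro ω hω hgood
    obtain ⟨hH, hY, hG, hV⟩ := hgood
    rw [← hr₂] at hH hY hG hV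
    obtain ⟨⟨-, hlt⟩, hmax⟩ := hthat N T hT ω
    -- On the good event a maximizer other than `t₀` would have a strictly smaller CUSUM than the
    -- admissible point `t₀`.
    exact (hmax ⟨hcp₁, hcp₂⟩).not_gt (cusum_lt_cusum_changePoint hθ hv (Real.sqrt_nonneg _)
      (by omega) hΔ hsmall hlow hupp hH hY hG hV hlt.le hω)
  have hlim : Tendsto (fun p : ℕ × ℕ => 1 - P {ω | that p.1 p.2 ω = changePoint θ p.2}ᶜ)
      atTop (𝓝 1) := by
    simpa using ENNReal.Tendsto.sub tendsto_const_nhds hfail (Or.inl ENNReal.one_ne_top)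
  refine tendsto_of_tendsto_of_tendsto_of_le_of_le hlim tendsto_const_nhds (fun p => ?_)
    fun p => prob_le_one
  rw [tsub_le_iff_right, ← measure_univ (μ := P),
    ← Set.union_compl_self {ω | that p.1 p.2 ω = changePoint θ p.2}]
  exact measure_union_le _ _
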